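/- Let $K$ be a field with a non-archimedean absolute value $|\cdot|$ and let $p \ge 0$ be the characteristic of its residue field $\{|x|\le 1\}/\{|x|<1\}$. Let $d \geq 2$ be an integer with $p > d$ or $p = 0$, and let $\varphi(z) \in K(z)$ be a rational function of degree $d$ (that is, $\varphi = f/g$ with $f, g\in K[z]$ coprime and $\max(\deg f, \deg g) = d$), regarded as a self-map of $\mathbb{P}^1(K) = K \cup \{\infty\}$. For a periodic point $\gamma\in\mathbb{P}^1(K)$ of $\varphi$ of minimal period $n \ge 1$, let $\varphi^n$ be the $n$-fold composition of $\varphi$ with itself and let $\lambda\in K$ be the multiplier of $\gamma$, i.e. $\lambda = (\varphi^n)'(\gamma)$ if $\gamma\neq\infty$, and $\lambda = \psi'(0)$ with $\psi(z) = 1/\varphi^n(1/z)$ if $\gamma = \infty$; the cycle $\{\gamma, \varphi(\gamma), \dots, \varphi^{n-1}(\gamma)\}$ is called attracting if $|\lambda| < 1$ (including the case $\lambda=0$). Then $\varphi$ has at most $2d - 2$ attracting cycles in $\mathbb{P}^1(K)$. -/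

import Mathlib

/-! Rational maps on the projective line over a field. The projective line `ℙ¹(K) = K ∪ {∞}` is
`OnePoint K`, and a rational map is an element `φ = f / g` of the field `RatFunc K = K(z)`, with
coprime numerator `f = φ.num` and denominator `g = φ.denom`. -/

namespace RatDyn

/-- The degree of a rational function `f / g` in lowest terms: `max (deg f) (deg g)`. -/
noncomputable def degree {K : Type*} [Field K] (φ : RatFunc K) : ℕ :=
  max φ.num.natDegree φ.denom.natDegree

open Classical in
/-- The self-map of `ℙ¹(K)` induced by `φ = f / g`. A point `x ∈ K` goes to `f(x) / g(x)`, or to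
`∞` if `g(x) = 0`. The point `∞` goes to `∞` if `deg f > deg g`; otherwise it goes to
the quotient of the coefficients of degree `deg g` of `f` and `g`
(which is `0` if `deg f < deg g`). -/
noncomputable def toMap {K : Type*} [Field K] (φ : RatFunc K) : OnePoint K → OnePoint K
  | OnePoint.infty =>
      if φ.denom.natDegree < φ.num.natDegree then OnePoint.infty
      else ((φ.num.coeff φ.denom.natDegree / φ.denom.leadingCoeff : K) : OnePoint K)
  | OnePoint.some x =>
      if φ.denom.eval x = 0 then OnePoint.infty
      else ((φ.num.eval x / φ.denom.eval x : K) : OnePoint K)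

/-- The composition `φ ∘ ψ = φ(ψ(z))` of rational functions (used for nonconstant `ψ`): substitute
`ψ` for the variable in the numerator and the denominator of `φ`. -/
noncomputable def comp {K : Type*} [Field K] (φ ψ : RatFunc K) : RatFunc K :=
  RatFunc.eval RatFunc.C ψ φ

/-- The `n`-fold composition `φⁿ = φ ∘ ⋯ ∘ φ` as a rational function, with `φ⁰ = z`. -/
noncomputable def iter {K : Type*} [Field K] (φ : RatFunc K) : ℕ → RatFunc K
  | 0 => RatFunc.X
  | n + 1 => comp φ (iter φ n)

/-- The value at `x ∈ K` of the formal derivative `ψ' = (f' g - f g') / g ^ 2` of `ψ = f / g`,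
at a point `x` that is not a pole of `ψ`. -/
noncomputable def derivAt {K : Type*} [Field K] (ψ : RatFunc K) (x : K) : K :=
  (ψ.num.derivative.eval x * ψ.denom.eval x - ψ.num.eval x * ψ.denom.derivative.eval x) /
    ψ.denom.eval x ^ 2

/-- The multiplier of a fixed point of `ψ`: it is `ψ'(x)` at `x ∈ K`, and at `∞` it is computed
after the change of coordinates `z ↦ 1 / z`, as the derivative at `0` of `1 / ψ(1 / z)`. -/
noncomputable def fixedMultiplier {K : Type*} [Field K] (ψ : RatFunc K) : OnePoint K → K
  | OnePoint.infty => derivAt (comp ψ (RatFunc.X)⁻¹)⁻¹ 0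
  | OnePoint.some x => derivAt ψ x

/-- The multiplier of a periodic point `γ` of `φ`: the multiplier of `γ` as a fixed point of `φⁿ`,
where `n` is the minimal period of `γ`. -/
noncomputable def multiplier {K : Type*} [Field K] (φ : RatFunc K) (γ : OnePoint K) : K :=
  fixedMultiplier (iter φ (Function.minimalPeriod (toMap φ) γ)) γ

/-- The attracting cycles of `φ` in `ℙ¹(K)`: the orbits of the periodic points whose multiplier
`lam` satisfies `|lam| < 1`. -/
def attractingCycles {K : Type*} [NormedField K] (φ : RatFunc K) : Set (Cycle (OnePoint K)) :=
  {c | ∃ γ ∈ Function.periodicPts (toMap φ),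
    ‖multiplier φ γ‖ < 1 ∧ c = Function.periodicOrbit (toMap φ) γ}

/-- The residue field of a field with a non-archimedean absolute value: the unit ball
`{x | |x| ≤ 1}` modulo its maximal ideal. -/
abbrev ResidueField (K : Type*) [NormedField K] [IsUltrametricDist K] : Type _ :=
  IsLocalRing.ResidueField (NormedField.valuation (K := K)).valuationSubring

end RatDyn

/-! As in complex dynamics, distinct attracting cycles attract distinct critical points, and a map
of degree d has at most 2d - 2 critical points; the assumption on p makes the map separable and its
ramification tame. An isometric algebraically closed extension (`exists_isAlgClosed_extension`)
changes neither degree nor multipliers and keeps distinct cycles distinct, so one may work there.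

Some fixed point is not attracting (`exists_nonattracting_fixedPoint`): otherwise, in the formula
saying that the sum of 1/(1 - λ) over the d + 1 fixed points is 1, every term would be congruent to
1 modulo the maximal ideal, whence |d| < 1. Moving that point to ∞ puts all attracting cycles in the
affine line; the map becomes f/g with deg g < deg f = d, and its finite critical points are the
roots of W = f'g - fg', of degree at most 2d - 2.

The core is `IsTame.exists_critical_isAttractedTo`. Suppose that λ ≠ 0 and no critical point is
attracted to the cycle of x. A small disc about x on which the iterates scale distances by their
derivatives can be pulled back along the cycle forever. Each turn multiplies its radius by 1/|λ|, so
f/g scales distances to x on the whole line. Then x is the only preimage of its image, with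
multiplicity d ≥ 2, so x is critical, a contradiction.

Pulling back rests on `exists_disc_of_no_critical`. A non-archimedean Riemann–Hurwitz formula
(`countP_critPoly_add_one`) counts zeros of W, f and g in a disc. Comparing a disc about x with the
discs about the poles inside it shows that, without critical values, there is no pole and just one
zero. -/

open Polynomial

namespace RatDyn

/-! ### Norms of polynomials on discs -/

section DiscNorm

variable {L : Type*} [NormedField L]

/-- The supremum norm of the polynomial `h` on the disc of centre `a` and radius `s`, expressed
through the roots of `h`. -/
noncomputable def discNorm (h : L[X]) (a : L) (s : ℝ) : ℝ :=
  ‖h.leadingCoeff‖ * (h.roots.map fun α => max s (dist a α)).prod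

lemma discNorm_nonneg (h : L[X]) (a : L) (s : ℝ) : 0 ≤ discNorm h a s := by
  refine mul_nonneg (norm_nonneg _) (Multiset.prod_nonneg ?_)
  intro x hx
  obtain ⟨α, -, rfl⟩ := Multiset.mem_map.1 hx
  exact le_max_of_le_right dist_nonneg

lemma discNorm_pos {h : L[X]} (hh : h ≠ 0) (a : L) {s : ℝ} (hs : 0 < s) : 0 < discNorm h a s := by
  refine mul_pos (norm_pos_iff.2 (leadingCoeff_ne_zero.2 hh)) (Multiset.prod_pos ?_)
  intro x hx
  obtain ⟨α, -, rfl⟩ := Multiset.mem_map.1 hx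
  exact lt_max_of_lt_left hs

lemma prod_max_mono (R : Multiset L) (a : L) {s t : ℝ} (hst : s ≤ t) :
    (R.map fun α => max s (dist a α)).prod ≤ (R.map fun α => max t (dist a α)).prod := by
  induction R using Multiset.induction_on with
  | empty => simp
  | cons β R ih =>
    simp only [Multiset.map_cons, Multiset.prod_cons]
    refine mul_le_mul (max_le_max_right _ hst) ih (Multiset.prod_nonneg ?_)
      (le_max_of_le_right dist_nonneg)
    intro x hx
    obtain ⟨α, -, rfl⟩ := Multiset.mem_map.1 hx
    exact le_max_of_le_right dist_nonneg

lemma discNorm_mono (h : L[X]) (a : L) {s t : ℝ} (hst : s ≤ t) :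
    discNorm h a s ≤ discNorm h a t :=
  mul_le_mul_of_nonneg_left (prod_max_mono _ _ hst) (norm_nonneg _)

lemma continuous_discNorm (h : L[X]) (a : L) : Continuous (discNorm h a) := by
  unfold discNorm
  refine continuous_const.mul ?_
  refine continuous_multiset_prod (f := fun α s => max s (dist a α)) h.roots ?_
  intro α _
  fun_prop

lemma norm_eval_eq_discNorm_zero [IsAlgClosed L] (h : L[X]) (a : L) :
    ‖h.eval a‖ = discNorm h a 0 := by
  rw [(IsAlgClosed.splits h).eval_eq_prod_roots, norm_mul, discNorm]
  congr 1
  induction h.roots using Multiset.induction_on with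
  | empty => simp
  | cons β R ih =>
    simp only [Multiset.map_cons, Multiset.prod_cons, norm_mul, ih, dist_eq_norm]
    rw [max_eq_right (norm_nonneg _)]

/-- Away from the radii of its roots, the disc norm is a monomial in the radius. -/
lemma exists_discNorm_eq_monomial {h : L[X]} (hh : h ≠ 0) (a : L) {s₁ s₂ : ℝ} (h0 : 0 ≤ s₁)
    (hR : ∀ α ∈ h.roots, dist a α ≤ s₁ ∨ s₂ ≤ dist a α) :
    ∃ C : ℝ, 0 < C ∧ ∀ s, s₁ < s → s < s₂ →
      discNorm h a s = C * s ^ h.roots.countP (fun α => dist a α ≤ s₁) := by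
  classical
  suffices ∀ R : Multiset L, (∀ α ∈ R, dist a α ≤ s₁ ∨ s₂ ≤ dist a α) →
      ∃ C : ℝ, 0 < C ∧ ∀ s, s₁ < s → s < s₂ →
        (R.map fun α => max s (dist a α)).prod = C * s ^ R.countP (fun α => dist a α ≤ s₁) by
    obtain ⟨C, hC, hC'⟩ := this _ hR
    refine ⟨‖h.leadingCoeff‖ * C, mul_pos (norm_pos_iff.2 (leadingCoeff_ne_zero.2 hh)) hC, ?_⟩
    intro s hs1 hs2
    rw [discNorm, hC' s hs1 hs2, mul_assoc]
  intro R
  induction R using Multiset.induction_on with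
  | empty => intro _; exact ⟨1, one_pos, by simp⟩
  | cons β R ih =>
    intro hR
    obtain ⟨C, hC, hC'⟩ := ih fun α hα => hR α (Multiset.mem_cons_of_mem hα)
    by_cases hβ : dist a β ≤ s₁
    · refine ⟨C, hC, fun s hs1 hs2 => ?_⟩
      rw [Multiset.map_cons, Multiset.prod_cons, hC' s hs1 hs2,
        Multiset.countP_cons_of_pos (p := fun α => dist a α ≤ s₁) _ hβ,
        max_eq_left (hβ.trans hs1.le), pow_succ]
      ring
    · have h2 : s₂ ≤ dist a β := (hR β (Multiset.mem_cons_self _ _)).resolve_left hβ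
      push Not at hβ
      refine ⟨dist a β * C, mul_pos (h0.trans_lt hβ) hC, fun s hs1 hs2 => ?_⟩
      rw [Multiset.map_cons, Multiset.prod_cons, hC' s hs1 hs2,
        Multiset.countP_cons_of_neg (p := fun α => dist a α ≤ s₁) _ (not_le.2 hβ),
        max_eq_right (hs2.le.trans h2)]
      ring

/-- There are finitely many roots, so a thin annulus just inside radius ρ avoids them. There
`exists_discNorm_eq_monomial` applies. -/
lemma exists_gap_left (R : Multiset L) (a : L) {ρ : ℝ} (hρ : 0 < ρ) :
    ∃ s, 0 ≤ s ∧ s < ρ ∧ ∀ α ∈ R, dist a α ≤ s ∨ ρ ≤ dist a α := by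
  induction R using Multiset.induction_on with
  | empty => exact ⟨0, le_rfl, hρ, by simp⟩
  | cons β R ih =>
    obtain ⟨s, hs0, hs, hR⟩ := ih
    by_cases hβ : ρ ≤ dist a β
    · exact ⟨s, hs0, hs, by simpa [hβ] using hR⟩
    · refine ⟨max s (dist a β), le_max_of_le_left hs0, max_lt hs (not_le.1 hβ), ?_⟩
      intro α hα
      rcases Multiset.mem_cons.1 hα with rfl | hα
      · exact Or.inl (le_max_right _ _)
      · exact (hR α hα).imp_left fun h => h.trans (le_max_left _ _)

lemma exists_gap_right (R : Multiset L) (a : L) {ρ τ : ℝ} (hρ : ρ < τ) :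
    ∃ s, ρ < s ∧ s ≤ τ ∧ ∀ α ∈ R, dist a α ≤ ρ ∨ s ≤ dist a α := by
  induction R using Multiset.induction_on with
  | empty => exact ⟨τ, hρ, le_rfl, by simp⟩
  | cons β R ih =>
    obtain ⟨s, hs0, hs, hR⟩ := ih
    by_cases hβ : dist a β ≤ ρ
    · exact ⟨s, hs0, hs, by simpa [hβ] using hR⟩
    · refine ⟨min s (dist a β), lt_min hs0 (not_le.1 hβ), min_le_of_left_le hs, ?_⟩
      intro α hα
      rcases Multiset.mem_cons.1 hα with rfl | hα
      · exact Or.inr (min_le_right _ _)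
      · exact (hR α hα).imp_right fun h => (min_le_left _ _).trans h

/-- A polynomial has constant norm on discs without roots. -/
lemma discNorm_eq_norm_eval [IsAlgClosed L] {h : L[X]} {a : L} {s : ℝ}
    (hz : ∀ α ∈ h.roots, s ≤ dist a α) : discNorm h a s = ‖h.eval a‖ := by
  rw [norm_eval_eq_discNorm_zero, discNorm, discNorm]
  congr 2
  refine Multiset.map_congr rfl fun α hα => ?_
  rw [max_eq_right (hz α hα), max_eq_right dist_nonneg]

/-- In an algebraically closed field with a nontrivial absolute value, every annulus has points. -/
lemma exists_dist_mem_Ioo [IsAlgClosed L] {π : L} (h0 : π ≠ 0) (h1 : ‖π‖ < 1) (a : L) {s₁ s₂ : ℝ}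
    (hs0 : 0 ≤ s₁) (hs : s₁ < s₂) : ∃ z, s₁ < dist z a ∧ dist z a < s₂ := by
  obtain ⟨t, ht1, ht2⟩ := exists_between hs
  have ht0 : 0 < t := hs0.trans_lt ht1
  have hs2 : 0 < s₂ := ht0.trans ht2
  have hπ : 0 < ‖π‖ := norm_pos_iff.2 h0
  have hq : t / s₂ < 1 := (div_lt_one hs2).2 ht2
  have hq0 : 0 < t / s₂ := by positivity
  obtain ⟨n, hn⟩ := exists_pow_lt_of_lt_one hπ hq
  have hn0 : n ≠ 0 := by rintro rfl; simp at hn; linarith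
  -- The root u has absolute value so close to 1 that the powers of u⁻¹ cannot jump over the
  -- interval from t to s₂.
  obtain ⟨u, hu⟩ := IsAlgClosed.exists_pow_nat_eq π (Nat.pos_of_ne_zero hn0)
  have hun : ‖u‖ ^ n = ‖π‖ := by rw [← norm_pow, hu]
  have hu0 : 0 < ‖u‖ := by
    rw [norm_pos_iff]; rintro rfl; rw [zero_pow hn0] at hu; exact h0 hu.symm
  have hu1 : ‖u‖ < 1 := by
    by_contra hcon
    have := one_le_pow₀ (n := n) (not_lt.1 hcon)
    linarith
  have huq : t / s₂ < ‖u‖ := lt_of_pow_lt_pow_left₀ n hu0.le (hun ▸ hn)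
  obtain ⟨k, hk1, hk2⟩ := exists_mem_Ioc_zpow hs2 ((one_lt_inv₀ hu0).2 hu1)
  refine ⟨a + u⁻¹ ^ k, ?_, ?_⟩
  · rw [dist_eq_norm, add_sub_cancel_left, norm_zpow, norm_inv]
    rw [zpow_add_one₀ (inv_ne_zero hu0.ne')] at hk2
    rw [div_lt_iff₀ hs2] at huq
    have : ‖u‖ * s₂ ≤ ‖u‖⁻¹ ^ k := by
      calc ‖u‖ * s₂ ≤ ‖u‖ * (‖u‖⁻¹ ^ k * ‖u‖⁻¹) := by gcongr
        _ = ‖u‖⁻¹ ^ k := by field_simp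
    linarith
  · rwa [dist_eq_norm, add_sub_cancel_left, norm_zpow, norm_inv]

variable [IsUltrametricDist L]

lemma max_dist_eq_of_dist_le {a b : L} {s : ℝ} (hab : dist a b ≤ s) (α : L) :
    max s (dist a α) = max s (dist b α) := by
  apply le_antisymm
  · exact max_le (le_max_left _ _)
      ((dist_triangle_max a b α).trans (max_le_max_right _ hab))
  · exact max_le (le_max_left _ _)
      ((dist_triangle_max b a α).trans (max_le_max_right _ (dist_comm a b ▸ hab)))

lemma discNorm_eq_of_dist_le (h : L[X]) {a b : L} {s : ℝ} (hab : dist a b ≤ s) :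
    discNorm h a s = discNorm h b s := by
  simp only [discNorm, max_dist_eq_of_dist_le hab]

lemma norm_eval_le_discNorm [IsAlgClosed L] (h : L[X]) {a z : L} {s : ℝ} (hz : dist z a ≤ s) :
    ‖h.eval z‖ ≤ discNorm h a s := by
  rw [norm_eval_eq_discNorm_zero, ← discNorm_eq_of_dist_le h hz]
  exact discNorm_mono _ _ (dist_nonneg.trans hz)

lemma dist_eq_max_of_ne {a z α : L} (h : dist z a ≠ dist a α) :
    dist z α = max (dist z a) (dist a α) :=
  IsUltrametricDist.dist_eq_max_of_dist_ne_dist _ _ _ h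

lemma norm_eval_eq_discNorm [IsAlgClosed L] {h : L[X]} {a z : L}
    (hz : ∀ α ∈ h.roots, dist z a ≠ dist a α) :
    ‖h.eval z‖ = discNorm h a (dist z a) := by
  rw [norm_eval_eq_discNorm_zero, discNorm, discNorm]
  congr 2
  refine Multiset.map_congr rfl fun α hα => ?_
  rw [max_eq_right dist_nonneg, dist_eq_max_of_ne (hz α hα)]

/-- When R consists of the roots of h, the sum is (z - a)h'(z)/h(z). A root inside the annulus
contributes 1 plus (β - a)/(z - β), which is small; a root outside contributes a small term. So the
logarithmic derivative counts inner roots modulo the maximal ideal. -/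
lemma norm_sum_div_sub_countP_lt (R : Multiset L) {a z : L} {s₁ s₂ : ℝ} (h1 : s₁ < dist z a)
    (h2 : dist z a < s₂) (h0 : 0 ≤ s₁) (hR : ∀ α ∈ R, dist a α ≤ s₁ ∨ s₂ ≤ dist a α) :
    ‖(R.map fun α => (z - a) * (1 / (z - α))).sum -
      (R.countP (fun α => dist a α ≤ s₁) : ℕ)‖ < 1 := by
  classical
  induction R using Multiset.induction_on with
  | empty => simp
  | cons β R ih =>
    have ih := ih fun α hα => hR α (Multiset.mem_cons_of_mem hα)
    have key : ∀ x y : L, ‖x‖ < 1 → ‖y‖ < 1 → ‖x + y‖ < 1 := fun x y hx hy =>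
      (IsUltrametricDist.norm_add_le_max x y).trans_lt (max_lt hx hy)
    rw [Multiset.map_cons, Multiset.sum_cons]
    by_cases hβ : dist a β ≤ s₁
    · rw [Multiset.countP_cons_of_pos (p := fun α => dist a α ≤ s₁) _ hβ]
      have hlt : dist a β < dist z a := hβ.trans_lt h1
      have hd : dist z β = dist z a := by rw [dist_eq_max_of_ne hlt.ne', max_eq_left hlt.le]
      have hne : z - β ≠ 0 := by
        rw [← norm_pos_iff, ← dist_eq_norm, hd]; exact h0.trans_lt h1
      have e : (z - a) * (1 / (z - β)) - 1 = (β - a) / (z - β) := by field_simp; ring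
      have : ‖(z - a) * (1 / (z - β)) - 1‖ < 1 := by
        rw [e, norm_div, div_lt_one (norm_pos_iff.2 hne), ← dist_eq_norm, ← dist_eq_norm, hd,
          dist_comm]
        exact hlt
      convert key _ _ this ih using 2
      push_cast
      ring
    · rw [Multiset.countP_cons_of_neg (p := fun α => dist a α ≤ s₁) _ hβ]
      have hlt : dist z a < dist a β :=
        h2.trans_le ((hR β (Multiset.mem_cons_self _ _)).resolve_left hβ)
      have hd : dist z β = dist a β := by rw [dist_eq_max_of_ne hlt.ne, max_eq_right hlt.le]
      have : ‖(z - a) * (1 / (z - β))‖ < 1 := by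
        rw [mul_one_div, norm_div, ← dist_eq_norm, ← dist_eq_norm, hd, div_lt_one]
        · exact hlt
        · exact dist_nonneg.trans_lt hlt
      convert key _ _ this ih using 2
      ring

/-- The numerator `f' g - f g'` of the derivative of `f / g`. -/
noncomputable def critPoly {F : Type*} [Field F] (f g : F[X]) : F[X] :=
  derivative f * g - f * derivative g

/-- Riemann–Hurwitz on an annulus: where `f / g` behaves like a monomial of exponent prime to the
residue characteristic, the numbers of zeros of `f`, `g` and `f' g - f g'` inside are related. -/
lemma countP_critPoly_add_one [IsAlgClosed L] {f g : L[X]} {π : L} (h0 : π ≠ 0) (h1 : ‖π‖ < 1)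
    (hf : f ≠ 0) (hg : g ≠ 0) {a : L} {s₁ s₂ : ℝ} (hs0 : 0 ≤ s₁) (hs : s₁ < s₂)
    (hRf : ∀ α ∈ f.roots, dist a α ≤ s₁ ∨ s₂ ≤ dist a α)
    (hRg : ∀ α ∈ g.roots, dist a α ≤ s₁ ∨ s₂ ≤ dist a α)
    (hRW : ∀ α ∈ (critPoly f g).roots, dist a α ≤ s₁ ∨ s₂ ≤ dist a α)
    (hunit : ‖((f.roots.countP (fun α => dist a α ≤ s₁) : ℕ) : L) -
      (g.roots.countP (fun α => dist a α ≤ s₁) : ℕ)‖ = 1) :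
    (critPoly f g).roots.countP (fun α => dist a α ≤ s₁) + 1 =
      f.roots.countP (fun α => dist a α ≤ s₁) + g.roots.countP (fun α => dist a α ≤ s₁) := by
  classical
  -- With W = f'g - fg', the quantity (z - a)W/(fg) is a difference of logarithmic derivatives,
  -- hence congruent to the difference of the two root counts, which is a unit by `hunit`.
  have key : ∀ z, s₁ < dist z a → dist z a < s₂ →
      ‖(critPoly f g).eval z‖ * dist z a = discNorm f a (dist z a) * discNorm g a (dist z a) := by
    intro z hz1 hz2
    have hne : ∀ h : L[X], (∀ α ∈ h.roots, dist a α ≤ s₁ ∨ s₂ ≤ dist a α) →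
        ∀ α ∈ h.roots, dist z a ≠ dist a α := by
      intro h hh α hα heq
      rcases hh α hα with h' | h' <;> linarith
    have hz0 : 0 < dist z a := hs0.trans_lt hz1
    have ef := norm_eval_eq_discNorm (hne f hRf)
    have eg := norm_eval_eq_discNorm (hne g hRg)
    have hf0 : f.eval z ≠ 0 := by
      rw [← norm_pos_iff, ef]; exact discNorm_pos hf _ hz0
    have hg0 : g.eval z ≠ 0 := by
      rw [← norm_pos_iff, eg]; exact discNorm_pos hg _ hz0
    have df := (IsAlgClosed.splits f).eval_derivative_eq_eval_mul_sum hf0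
    have dg := (IsAlgClosed.splits g).eval_derivative_eq_eval_mul_sum hg0
    have sf := norm_sum_div_sub_countP_lt f.roots hz1 hz2 hs0 hRf
    have sg := norm_sum_div_sub_countP_lt g.roots hz1 hz2 hs0 hRg
    rw [Multiset.sum_map_mul_left] at sf sg
    set Sf := (f.roots.map fun α => 1 / (z - α)).sum
    set Sg := (g.roots.map fun α => 1 / (z - α)).sum
    have e : (critPoly f g).eval z * (z - a) =
        f.eval z * g.eval z * ((z - a) * Sf - (z - a) * Sg) := by
      simp only [critPoly, eval_sub, eval_mul, df, dg]
      ring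
    have hS : ‖(z - a) * Sf - (z - a) * Sg‖ = 1 := by
      set nf : L := ((f.roots.countP (fun α => dist a α ≤ s₁) : ℕ) : L)
      set ng : L := ((g.roots.countP (fun α => dist a α ≤ s₁) : ℕ) : L)
      have hsmall : ‖((z - a) * Sf - nf) - ((z - a) * Sg - ng)‖ < 1 :=
        sub_eq_add_neg ((z - a) * Sf - nf) _ ▸ (IsUltrametricDist.norm_add_le_max _ _).trans_lt
          (max_lt sf (by rwa [norm_neg]))
      have e2 : (z - a) * Sf - (z - a) * Sg =
        (((z - a) * Sf - nf) - ((z - a) * Sg - ng)) + (nf - ng) := by ring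
      rw [e2, IsUltrametricDist.norm_add_eq_max_of_norm_ne_norm (by rw [hunit]; exact hsmall.ne),
        hunit, max_eq_right hsmall.le]
    rw [dist_eq_norm, ← norm_mul, e, norm_mul, norm_mul, hS, mul_one, ef, eg, dist_eq_norm]
  -- On the annulus both sides of `key` are monomials in the radius; comparing them at two different
  -- radii equates the exponents.
  obtain ⟨z, hz1, hz2⟩ := exists_dist_mem_Ioo h0 h1 a hs0 hs
  obtain ⟨w, hw1, hw2⟩ := exists_dist_mem_Ioo h0 h1 a dist_nonneg hz2
  have hz0 : 0 < dist z a := hs0.trans_lt hz1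
  have hw0 : 0 < dist w a := hz0.trans hw1
  have hWz : (critPoly f g).eval z ≠ 0 := by
    intro h
    have := key z hz1 hz2
    rw [h, norm_zero, zero_mul] at this
    exact (mul_pos (discNorm_pos hf a hz0) (discNorm_pos hg a hz0)).ne this
  have hW : critPoly f g ≠ 0 := by rintro h; simp [h] at hWz
  obtain ⟨Cf, hCf, ef⟩ := exists_discNorm_eq_monomial hf a hs0 hRf
  obtain ⟨Cg, hCg, eg⟩ := exists_discNorm_eq_monomial hg a hs0 hRg
  obtain ⟨CW, hCW, eW⟩ := exists_discNorm_eq_monomial hW a hs0 hRW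
  set nf := f.roots.countP (fun α => dist a α ≤ s₁)
  set ng := g.roots.countP (fun α => dist a α ≤ s₁)
  set nW := (critPoly f g).roots.countP (fun α => dist a α ≤ s₁)
  have hmono : ∀ y, s₁ < dist y a → dist y a < s₂ →
      CW * dist y a ^ (nW + 1) = Cf * Cg * dist y a ^ (nf + ng) := by
    intro y hy1 hy2
    have hk := key y hy1 hy2
    rw [norm_eval_eq_discNorm, eW _ hy1 hy2, ef _ hy1 hy2, eg _ hy1 hy2] at hk
    · rw [pow_succ, pow_add]; linarith
    · intro α hα heq
      rcases hRW α hα with h' | h' <;> linarith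
  have hz := hmono z hz1 hz2
  have hw := hmono w (hz1.trans hw1) hw2
  have hratio : (dist w a / dist z a) ^ (nW + 1) = (dist w a / dist z a) ^ (nf + ng) := by
    rw [div_pow, div_pow, div_eq_div_iff (by positivity) (by positivity)]
    have : CW * (Cf * Cg) * (dist w a ^ (nW + 1) * dist z a ^ (nf + ng)) =
        CW * (Cf * Cg) * (dist w a ^ (nf + ng) * dist z a ^ (nW + 1)) := by
      calc _ = (CW * dist w a ^ (nW + 1)) * (Cf * Cg * dist z a ^ (nf + ng)) := by ring
        _ = _ := by rw [hw, ← hz]; ring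
    exact mul_left_cancel₀ (by positivity) this
  exact pow_right_injective₀ (by positivity) ((one_lt_div hz0).2 hw1).ne' hratio

end DiscNorm

/-! ### Radii where |f/g| crosses a level, and Riemann–Hurwitz counts on discs -/

section Pullback

variable {L : Type*} [NormedField L]

open Classical in
lemma sum_countP_mem_eq {ι : Type*} (R : Multiset ι) (𝓑 : Finset (Set ι))
    (h𝓑 : (𝓑 : Set (Set ι)).PairwiseDisjoint id) {q : ι → Prop} [DecidablePred q]
    (hq : ∀ α, q α ↔ ∃ B ∈ 𝓑, α ∈ B) :
    ∑ B ∈ 𝓑, R.countP (· ∈ B) = R.countP q := by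
  induction R using Multiset.induction_on with
  | empty => simp
  | cons β R ih =>
    simp only [Multiset.countP_cons, Finset.sum_add_distrib, ih]
    congr 1
    split_ifs with h
    · obtain ⟨B, hB, hβ⟩ := (hq β).1 h
      rw [Finset.sum_eq_single_of_mem B hB, if_pos hβ]
      intro B' hB' hne
      rw [if_neg]
      intro hβ'
      exact Set.disjoint_left.1 (h𝓑 hB' hB hne) hβ' hβ
    · refine Finset.sum_eq_zero fun B hB => ?_
      rw [if_neg]
      exact fun hβ => h ((hq β).2 ⟨B, hB, hβ⟩)

lemma countP_le_countP {ι : Type*} {R : Multiset ι} {p q : ι → Prop} [DecidablePred p] [DecidablePred q]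
    (hpq : ∀ α ∈ R, p α → q α) : R.countP p ≤ R.countP q := by
  classical
  induction R using Multiset.induction_on with
  | empty => simp
  | cons β R ih =>
    have := ih fun α hα => hpq α (Multiset.mem_cons_of_mem hα)
    have := hpq β (Multiset.mem_cons_self _ _)
    simp only [Multiset.countP_cons]
    split_ifs <;> grind

lemma countP_lt_countP {ι : Type*} {R : Multiset ι} {p q : ι → Prop} [DecidablePred p] [DecidablePred q]
    (hpq : ∀ α ∈ R, p α → q α) {x : ι} (hx : x ∈ R) (hqx : q x) (hpx : ¬ p x) :
    R.countP p < R.countP q := by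
  classical
  obtain ⟨R, rfl⟩ := Multiset.exists_cons_of_mem hx
  rw [Multiset.countP_cons_of_pos _ hqx, Multiset.countP_cons_of_neg _ hpx, Nat.lt_succ_iff]
  exact countP_le_countP fun α hα => hpq α (Multiset.mem_cons_of_mem hα)

/-- The ratio of disc norms first reaches the value `r` at some radius `ρ`. -/
lemma exists_first_radius [IsAlgClosed L] {f g : L[X]} (hdeg : g.natDegree < f.natDegree) {x : L}
    (hg : g ≠ 0) (hfx : f.eval x = 0) (hgx : g.eval x ≠ 0) {r : ℝ} (hr : 0 < r) :
    ∃ ρ, 0 < ρ ∧ discNorm f x ρ = r * discNorm g x ρ ∧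
      ∀ s, 0 ≤ s → s < ρ → discNorm f x s < r * discNorm g x s := by
  have hf : f ≠ 0 := by rintro rfl; simp at hdeg
  let T : Set ℝ := {s | 0 ≤ s ∧ r * discNorm g x s ≤ discNorm f x s}
  have hTc : IsClosed T := isClosed_Ici.inter
    (isClosed_le (continuous_const.mul (continuous_discNorm g x)) (continuous_discNorm f x))
  have hTb : BddBelow T := ⟨0, fun s hs => hs.1⟩
  -- Beyond all roots a disc norm is |leading coefficient| times s to the degree, so deg g < deg f
  -- makes the ratio exceed r eventually.
  have hTne : T.Nonempty := by
    obtain ⟨M, hM⟩ : ∃ M : ℝ, 0 ≤ M ∧ ∀ α ∈ f.roots + g.roots, dist x α ≤ M := by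
      induction f.roots + g.roots using Multiset.induction_on with
      | empty => exact ⟨0, le_rfl, by simp⟩
      | cons β R ih =>
        obtain ⟨M, h0, hM⟩ := ih
        refine ⟨max M (dist x β), le_max_of_le_left h0, fun α hα => ?_⟩
        rcases Multiset.mem_cons.1 hα with rfl | hα
        · exact le_max_right _ _
        · exact (hM α hα).trans (le_max_left _ _)
    have big : ∀ h : L[X], (∀ α ∈ h.roots, dist x α ≤ M) → ∀ s, M ≤ s →
        discNorm h x s = ‖h.leadingCoeff‖ * s ^ h.natDegree := by
      intro h hh s hs
      rw [discNorm, (IsAlgClosed.splits h).natDegree_eq_card_roots]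
      congr 1
      rw [Multiset.map_congr rfl fun α hα => max_eq_left ((hh α hα).trans hs)]
      simp
    have hlf : 0 < ‖f.leadingCoeff‖ := norm_pos_iff.2 (leadingCoeff_ne_zero.2 hf)
    have hlg : 0 < ‖g.leadingCoeff‖ := norm_pos_iff.2 (leadingCoeff_ne_zero.2 hg)
    let s := max (max M 1) (r * ‖g.leadingCoeff‖ / ‖f.leadingCoeff‖)
    have hs1 : 1 ≤ s := (le_max_right _ _).trans (le_max_left _ _)
    have hsM : M ≤ s := (le_max_left _ _).trans (le_max_left _ _)
    refine ⟨s, zero_le_one.trans hs1, ?_⟩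
    rw [big f (fun α hα => hM.2 α (Multiset.mem_add.2 (Or.inl hα))) s hsM,
      big g (fun α hα => hM.2 α (Multiset.mem_add.2 (Or.inr hα))) s hsM]
    have h1 : r * ‖g.leadingCoeff‖ ≤ s * ‖f.leadingCoeff‖ := by
      rw [← div_le_iff₀ hlf]; exact le_max_right _ _
    calc r * (‖g.leadingCoeff‖ * s ^ g.natDegree)
        = r * ‖g.leadingCoeff‖ * s ^ g.natDegree := by ring
      _ ≤ s * ‖f.leadingCoeff‖ * s ^ g.natDegree := by gcongr
      _ = ‖f.leadingCoeff‖ * s ^ (g.natDegree + 1) := by ring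
      _ ≤ ‖f.leadingCoeff‖ * s ^ f.natDegree := by gcongr; exact hdeg
  have hmem : sInf T ∈ T := hTc.csInf_mem hTne hTb
  have hlt : ∀ s, 0 ≤ s → s < sInf T → discNorm f x s < r * discNorm g x s := by
    intro s hs0 hs
    by_contra hcon
    exact absurd (csInf_le hTb ⟨hs0, not_lt.1 hcon⟩) (not_le.2 hs)
  have hpos : 0 < sInf T := by
    refine lt_of_le_of_ne hmem.1 fun h => ?_
    have := hmem.2
    rw [← h, ← norm_eval_eq_discNorm_zero, ← norm_eval_eq_discNorm_zero, hfx, norm_zero] at this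
    exact absurd this (not_le.2 (mul_pos hr (norm_pos_iff.2 hgx)))
  refine ⟨sInf T, hpos, le_antisymm ?_ hmem.2, hlt⟩
  have hcl : sInf T ∈ closure (Set.Ico 0 (sInf T)) := by
    rw [closure_Ico hpos.ne]; exact ⟨hpos.le, le_rfl⟩
  have hsub : closure (Set.Ico 0 (sInf T)) ⊆ {s | discNorm f x s ≤ r * discNorm g x s} :=
    closure_minimal (fun s hs => (hlt s hs.1 hs.2).le)
      (isClosed_le (continuous_discNorm f x) (continuous_const.mul (continuous_discNorm g x)))
  exact hsub hcl

/-- Around a pole `b`, the ratio of disc norms last takes a value `≥ r` at some radius `σ < τ`. -/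
lemma exists_last_radius [IsAlgClosed L] {f g : L[X]} {b : L} (hfb : f.eval b ≠ 0)
    (hgb : g.eval b = 0) {r τ : ℝ} (hτ0 : 0 ≤ τ) (hτ : discNorm f b τ < r * discNorm g b τ) :
    ∃ σ, 0 < σ ∧ σ < τ ∧ discNorm f b σ = r * discNorm g b σ ∧
      ∀ s, σ < s → s ≤ τ → discNorm f b s < r * discNorm g b s := by
  let T : Set ℝ := {s | s ∈ Set.Icc 0 τ ∧ r * discNorm g b s ≤ discNorm f b s}
  have hTc : IsClosed T := isClosed_Icc.inter
    (isClosed_le (continuous_const.mul (continuous_discNorm g b)) (continuous_discNorm f b))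
  have hTb : BddAbove T := ⟨τ, fun s hs => hs.1.2⟩
  have h0 : (0 : ℝ) ∈ T := by
    refine ⟨⟨le_rfl, hτ0⟩, ?_⟩
    rw [← norm_eval_eq_discNorm_zero, hgb, norm_zero, mul_zero]
    exact discNorm_nonneg _ _ _
  have hmem : sSup T ∈ T := hTc.csSup_mem ⟨0, h0⟩ hTb
  have hστ : sSup T < τ := lt_of_le_of_ne hmem.1.2 fun h => by
    have := hmem.2; rw [h] at this; linarith
  have hlt : ∀ s, sSup T < s → s ≤ τ → discNorm f b s < r * discNorm g b s := by
    intro s hs hsτ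
    by_contra hcon
    exact absurd (le_csSup hTb ⟨⟨hmem.1.1.trans hs.le, hsτ⟩, not_lt.1 hcon⟩) (not_le.2 hs)
  have hcl : sSup T ∈ closure (Set.Ioc (sSup T) τ) := by
    rw [closure_Ioc hστ.ne]; exact ⟨le_rfl, hστ.le⟩
  have hsub : closure (Set.Ioc (sSup T) τ) ⊆ {s | discNorm f b s ≤ r * discNorm g b s} :=
    closure_minimal (fun s hs => (hlt s hs.1 hs.2).le)
      (isClosed_le (continuous_discNorm f b) (continuous_const.mul (continuous_discNorm g b)))
  have heq := le_antisymm (hsub hcl) hmem.2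
  refine ⟨sSup T, lt_of_le_of_ne hmem.1.1 fun h => ?_, hστ, heq, hlt⟩
  have := heq
  rw [← h, ← norm_eval_eq_discNorm_zero, ← norm_eval_eq_discNorm_zero, hgb, norm_zero,
    mul_zero] at this
  exact hfb (norm_eq_zero.1 this)

/-- This is how the residue characteristic enters the counts: numbers of roots lie between 0 and d,
so two different ones differ by a unit. -/
lemma norm_natCast_sub_natCast_eq_one {d : ℕ} (hd : ∀ m : ℕ, 1 ≤ m → m ≤ d → ‖(m : L)‖ = 1)
    {m n : ℕ} (hm : m ≤ d) (hn : n ≤ d) (hmn : m ≠ n) : ‖(m : L) - (n : L)‖ = 1 := by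
  wlog h : n < m generalizing m n
  · rw [norm_sub_rev]
    exact this hn hm hmn.symm (by omega)
  · rw [← Nat.cast_sub h.le]
    exact hd _ (by omega) (by omega)

variable [IsUltrametricDist L] [IsAlgClosed L]

/-- Riemann–Hurwitz count in an open disc whose outer boundary is mapped to radius `r`. -/
lemma countP_critPoly_ball {f g : L[X]} {π : L} (h0 : π ≠ 0) (h1 : ‖π‖ < 1) {d : ℕ}
    (hd : ∀ m : ℕ, 1 ≤ m → m ≤ d → ‖(m : L)‖ = 1) (hfd : f.natDegree ≤ d) (hgd : g.natDegree ≤ d)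
    (hf : f ≠ 0) (hg : g ≠ 0) {a : L} {r ρ : ℝ} (hρ : 0 < ρ)
    (heq : discNorm f a ρ = r * discNorm g a ρ)
    (hlt : ∃ t, 0 ≤ t ∧ t < ρ ∧ ∀ s, t < s → s < ρ → discNorm f a s < r * discNorm g a s) :
    (critPoly f g).roots.countP (fun α => dist a α < ρ) + 1 =
      f.roots.countP (fun α => dist a α < ρ) + g.roots.countP (fun α => dist a α < ρ) := by
  obtain ⟨t, ht0, htρ, hlt⟩ := hlt
  obtain ⟨s₀, hs0, hsρ, hR⟩ := exists_gap_left (f.roots + g.roots + (critPoly f g).roots) a hρ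
  set s₁ := max s₀ t
  have hs1 : s₁ < ρ := max_lt hsρ htρ
  have hs10 : 0 ≤ s₁ := hs0.trans (le_max_left _ _)
  have hR' : ∀ α ∈ f.roots + g.roots + (critPoly f g).roots, dist a α ≤ s₁ ∨ ρ ≤ dist a α :=
    fun α hα => (hR α hα).imp_left fun h => h.trans (le_max_left _ _)
  have hRf : ∀ α ∈ f.roots, dist a α ≤ s₁ ∨ ρ ≤ dist a α := fun α hα => hR' α (by simp_all)
  have hRg : ∀ α ∈ g.roots, dist a α ≤ s₁ ∨ ρ ≤ dist a α := fun α hα => hR' α (by simp_all)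
  have hRW : ∀ α ∈ (critPoly f g).roots, dist a α ≤ s₁ ∨ ρ ≤ dist a α := fun α hα => hR' α (by
    simp only [Multiset.mem_add]; exact Or.inr hα)
  have hc : ∀ R : Multiset L, (∀ α ∈ R, dist a α ≤ s₁ ∨ ρ ≤ dist a α) →
      R.countP (fun α => dist a α < ρ) = R.countP (fun α => dist a α ≤ s₁) := by
    intro R hR
    refine Multiset.countP_congr rfl fun α hα => propext
      ⟨fun h => (hR α hα).resolve_right (not_le.2 h), fun h => h.trans_lt hs1⟩
  rw [hc _ hRf, hc _ hRg, hc _ hRW]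
  refine countP_critPoly_add_one h0 h1 hf hg hs10 hs1 hRf hRg hRW
    (norm_natCast_sub_natCast_eq_one hd ?_ ?_ ?_)
  · exact (Multiset.countP_le_card _ _).trans ((card_roots' f).trans hfd)
  · exact (Multiset.countP_le_card _ _).trans ((card_roots' g).trans hgd)
  -- Equal counts would make the ratio of disc norms constant on the annulus, hence equal to its
  -- boundary value r by continuity, against the strict inequality inside.
  · intro hn
    obtain ⟨Cf, hCf, ef⟩ := exists_discNorm_eq_monomial hf a hs10 hRf
    obtain ⟨Cg, hCg, eg⟩ := exists_discNorm_eq_monomial hg a hs10 hRg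
    set n := g.roots.countP (fun α => dist a α ≤ s₁)
    rw [hn] at ef
    have hcl : ρ ∈ closure (Set.Ioo s₁ ρ) := by
      rw [closure_Ioo hs1.ne]; exact ⟨hs1.le, le_rfl⟩
    have e1 : Set.EqOn (discNorm f a) (fun s => Cf * s ^ n) (closure (Set.Ioo s₁ ρ)) :=
      Set.EqOn.closure (fun s hs => ef s hs.1 hs.2) (continuous_discNorm f a) (by fun_prop)
    have e2 : Set.EqOn (discNorm g a) (fun s => Cg * s ^ n) (closure (Set.Ioo s₁ ρ)) :=
      Set.EqOn.closure (fun s hs => eg s hs.1 hs.2) (continuous_discNorm g a) (by fun_prop)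
    have e3 : (r * Cg) * ρ ^ n = Cf * ρ ^ n := by
      have := heq; rw [e1 hcl, e2 hcl] at this; simp only at this; linarith
    have e4 : r * Cg = Cf := mul_right_cancel₀ (by positivity) e3
    obtain ⟨s, hsa, hsb⟩ := exists_between hs1
    have := hlt s ((le_max_right _ _).trans_lt hsa) hsb
    rw [ef s hsa hsb, eg s hsa hsb, ← mul_assoc, e4] at this
    exact lt_irrefl _ this

/-- Riemann–Hurwitz count in a closed disc around a pole whose boundary is mapped to radius `r`. -/
lemma countP_critPoly_closedBall {f g : L[X]} {π : L} (h0 : π ≠ 0) (h1 : ‖π‖ < 1) {d : ℕ}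
    (hd : ∀ m : ℕ, 1 ≤ m → m ≤ d → ‖(m : L)‖ = 1) (hfd : f.natDegree ≤ d) (hgd : g.natDegree ≤ d)
    (hf : f ≠ 0) (hg : g ≠ 0) {a : L} {r σ τ : ℝ} (hσ : 0 < σ)
    (heq : discNorm f a σ = r * discNorm g a σ) (hστ : σ < τ)
    (hlt : ∀ s, σ < s → s ≤ τ → discNorm f a s < r * discNorm g a s) :
    (critPoly f g).roots.countP (fun α => dist a α ≤ σ) + 1 =
      f.roots.countP (fun α => dist a α ≤ σ) + g.roots.countP (fun α => dist a α ≤ σ) := by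
  obtain ⟨s₂, hs1, hsτ, hR⟩ := exists_gap_right (f.roots + g.roots + (critPoly f g).roots) a hστ
  have hRf : ∀ α ∈ f.roots, dist a α ≤ σ ∨ s₂ ≤ dist a α := fun α hα => hR α (by simp_all)
  have hRg : ∀ α ∈ g.roots, dist a α ≤ σ ∨ s₂ ≤ dist a α := fun α hα => hR α (by simp_all)
  have hRW : ∀ α ∈ (critPoly f g).roots, dist a α ≤ σ ∨ s₂ ≤ dist a α := fun α hα => hR α (by
    simp only [Multiset.mem_add]; exact Or.inr hα)
  refine countP_critPoly_add_one h0 h1 hf hg hσ.le hs1 hRf hRg hRW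
    (norm_natCast_sub_natCast_eq_one hd ?_ ?_ ?_)
  · exact (Multiset.countP_le_card _ _).trans ((card_roots' f).trans hfd)
  · exact (Multiset.countP_le_card _ _).trans ((card_roots' g).trans hgd)
  · intro hn
    obtain ⟨Cf, hCf, ef⟩ := exists_discNorm_eq_monomial hf a hσ.le hRf
    obtain ⟨Cg, hCg, eg⟩ := exists_discNorm_eq_monomial hg a hσ.le hRg
    set n := g.roots.countP (fun α => dist a α ≤ σ)
    rw [hn] at ef
    have hcl : σ ∈ closure (Set.Ioo σ s₂) := by
      rw [closure_Ioo hs1.ne]; exact ⟨le_rfl, hs1.le⟩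
    have e1 : Set.EqOn (discNorm f a) (fun s => Cf * s ^ n) (closure (Set.Ioo σ s₂)) :=
      Set.EqOn.closure (fun s hs => ef s hs.1 hs.2) (continuous_discNorm f a) (by fun_prop)
    have e2 : Set.EqOn (discNorm g a) (fun s => Cg * s ^ n) (closure (Set.Ioo σ s₂)) :=
      Set.EqOn.closure (fun s hs => eg s hs.1 hs.2) (continuous_discNorm g a) (by fun_prop)
    have e3 : (r * Cg) * σ ^ n = Cf * σ ^ n := by
      have := heq; rw [e1 hcl, e2 hcl] at this; simp only at this; linarith
    have e4 : r * Cg = Cf := mul_right_cancel₀ (by positivity) e3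
    obtain ⟨s, hsa, hsb⟩ := exists_between hs1
    have := hlt s hsa (hsb.le.trans hsτ)
    rw [ef s hsa hsb, eg s hsa hsb, ← mul_assoc, e4] at this
    exact lt_irrefl _ this

end Pullback

/-! ### Pulling back discs without critical values -/

section Pullback

variable {L : Type*} [NormedField L] [IsUltrametricDist L] [IsAlgClosed L]

/-- If the disc of radius `r` around `0` contains no critical value of `f / g`, then its preimage
around a zero `x` of `f` is a disc on which `f / g` has no pole and only one zero. -/
lemma exists_disc_of_no_critical {f g : L[X]} {π : L} (h0 : π ≠ 0) (h1 : ‖π‖ < 1)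
    (hd : ∀ m : ℕ, 1 ≤ m → m ≤ f.natDegree → ‖(m : L)‖ = 1) (hdeg : g.natDegree < f.natDegree)
    (hcop : ∀ z, f.eval z = 0 → g.eval z ≠ 0) (hW : critPoly f g ≠ 0)
    {x : L} (hfx : f.eval x = 0) {r : ℝ} (hr : 0 < r)
    (hcrit : ∀ c, (critPoly f g).eval c = 0 → r * ‖g.eval c‖ ≤ ‖f.eval c‖) :
    ∃ ρ, 0 < ρ ∧ discNorm f x ρ = r * discNorm g x ρ ∧
      f.roots.countP (fun α => dist x α < ρ) = 1 ∧ g.roots.countP (fun α => dist x α < ρ) = 0 := by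
  classical
  have hf : f ≠ 0 := by rintro rfl; simp at hdeg
  have hgx : g.eval x ≠ 0 := hcop x hfx
  have hg : g ≠ 0 := by rintro rfl; simp at hgx
  obtain ⟨ρ, hρ, heq, hlt⟩ := exists_first_radius hdeg hg hfx hgx hr
  -- Each pole in the ball gets a closed disc whose boundary has ratio r and beyond which, as far
  -- out as x, the ratio stays below r. The ball minus these discs plays the role of the component
  -- of the preimage containing x.
  have hpole : ∀ b : L, g.eval b = 0 → dist x b < ρ → ∃ σ, 0 < σ ∧ σ < dist x b ∧
      discNorm f b σ = r * discNorm g b σ ∧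
        ∀ s, σ < s → s ≤ dist x b → discNorm f b s < r * discNorm g b s := by
    intro b hb hbρ
    refine exists_last_radius (fun h => hcop b h hb) hb dist_nonneg ?_
    rw [← discNorm_eq_of_dist_le f le_rfl, ← discNorm_eq_of_dist_le g le_rfl]
    exact hlt _ dist_nonneg hbρ
  choose! σ hσ0 hσx hσeq hσlt using hpole
  -- balls around two poles are disjoint or equal
  have hcmp : ∀ b b' : L, g.eval b = 0 → dist x b < ρ → g.eval b' = 0 → dist x b' < ρ →
      dist b b' ≤ σ b → σ b ≤ σ b' := by
    intro b b' hb hbρ hb' hbρ' hbb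
    by_contra! hcon
    have hx : dist x b' = dist x b := by
      have hlt : dist b b' < dist x b := hbb.trans_lt (hσx b hb hbρ)
      rw [dist_eq_max_of_ne hlt.ne', max_eq_left hlt.le]
    have := hσlt b' hb' hbρ' (σ b) hcon (by rw [hx]; exact (hσx b hb hbρ).le)
    rw [← discNorm_eq_of_dist_le f hbb, ← discNorm_eq_of_dist_le g hbb, hσeq b hb hbρ] at this
    exact lt_irrefl _ this
  let P : Finset L := g.roots.toFinset.filter fun b => dist x b < ρ
  have hP : ∀ b ∈ P, g.eval b = 0 ∧ dist x b < ρ := by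
    intro b hb
    simp only [P, Finset.mem_filter, Multiset.mem_toFinset, mem_roots hg] at hb
    exact hb
  let 𝓑 : Finset (Set L) := P.image fun b => Metric.closedBall b (σ b)
  have hdisj : (𝓑 : Set (Set L)).PairwiseDisjoint id := by
    intro B hB B' hB' hne
    obtain ⟨b, hb, rfl⟩ := Finset.mem_image.1 (Finset.mem_coe.1 hB)
    obtain ⟨b', hb', rfl⟩ := Finset.mem_image.1 (Finset.mem_coe.1 hB')
    rw [Function.onFun, id, id, Set.disjoint_left]
    intro z hz hz'
    apply hne
    rw [Metric.mem_closedBall] at hz hz'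
    have hbb : dist b b' ≤ max (σ b) (σ b') :=
      (dist_triangle_max b z b').trans (max_le_max (dist_comm z b ▸ hz) hz')
    obtain ⟨hb1, hb2⟩ := hP b hb
    obtain ⟨hb1', hb2'⟩ := hP b' hb'
    have hle : dist b b' ≤ σ b ∧ σ b = σ b' := by
      rcases le_total (σ b') (σ b) with h | h
      · rw [max_eq_left h] at hbb
        exact ⟨hbb, le_antisymm (hcmp b b' hb1 hb2 hb1' hb2' hbb) h⟩
      · rw [max_eq_right h] at hbb
        have := le_antisymm h (hcmp b' b hb1' hb2' hb1 hb2 (dist_comm b b' ▸ hbb))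
        exact ⟨this ▸ hbb, this⟩
    rw [← hle.2]
    exact IsUltrametricDist.closedBall_eq_of_mem (by
      rw [Metric.mem_closedBall, dist_comm]; exact hle.1)
  let U : L → Prop := fun α => ∃ B ∈ 𝓑, α ∈ B
  have hUq : ∀ α, U α ↔ ∃ B ∈ 𝓑, α ∈ B := fun _ => Iff.rfl
  have hUD : ∀ α, U α → dist x α < ρ := by
    rintro α ⟨B, hB, hα⟩
    obtain ⟨b, hb, rfl⟩ := Finset.mem_image.1 hB
    obtain ⟨hb1, hb2⟩ := hP b hb
    rw [Metric.mem_closedBall, dist_comm] at hα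
    exact (dist_triangle_max x b α).trans_lt
      (max_lt hb2 (hα.trans_lt ((hσx b hb1 hb2).trans hb2)))
  have hUx : ¬ U x := by
    rintro ⟨B, hB, hα⟩
    obtain ⟨b, hb, rfl⟩ := Finset.mem_image.1 hB
    obtain ⟨hb1, hb2⟩ := hP b hb
    exact absurd (Metric.mem_closedBall.1 hα) (not_le.2 (hσx b hb1 hb2))
  -- A critical point c outside these discs would have |f(c)| < r|g(c)|, against `hcrit`. Take the
  -- pole b nearest to c: no zero of g is closer to c, so |g(c)| is the disc norm of g at radius |c
  -- - b|, while |f(c)| is at most that of f.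
  have hWU : ∀ c ∈ (critPoly f g).roots, dist x c < ρ → U c := by
    intro c hc hcρ
    by_contra hcU
    have hcr := hcrit c ((mem_roots hW).1 hc)
    by_cases hne : P.Nonempty
    · obtain ⟨b, hb, hmin⟩ := P.exists_min_image (fun b => dist c b) hne
      obtain ⟨hb1, hb2⟩ := hP b hb
      have hcb : dist c b < ρ := by
        rw [dist_comm] at hcρ
        exact (dist_triangle_max c x b).trans_lt (max_lt hcρ hb2)
      have hσc : σ b < dist c b := by
        by_contra! h
        exact hcU ⟨_, Finset.mem_image_of_mem _ hb, Metric.mem_closedBall.2 h⟩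
      have hgc : discNorm g c (dist c b) = ‖g.eval c‖ := by
        refine discNorm_eq_norm_eval fun α hα => ?_
        by_cases hαρ : dist x α < ρ
        · exact hmin α (by simp only [P, Finset.mem_filter, Multiset.mem_toFinset]; exact ⟨hα, hαρ⟩)
        · by_contra! hlt'
          exact hαρ ((dist_triangle_max x c α).trans_lt (max_lt hcρ (hlt'.trans hcb)))
      have hfc : ‖f.eval c‖ ≤ discNorm f c (dist c b) :=
        norm_eval_le_discNorm f (by simp)
      have key : discNorm f b (dist c b) < r * discNorm g b (dist c b) := by
        by_cases hbx : dist c b ≤ dist x b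
        · exact hσlt b hb1 hb2 _ hσc hbx
        · push Not at hbx
          rw [← discNorm_eq_of_dist_le f hbx.le, ← discNorm_eq_of_dist_le g hbx.le]
          exact hlt _ dist_nonneg hcb
      rw [← discNorm_eq_of_dist_le f le_rfl, ← discNorm_eq_of_dist_le g le_rfl, hgc] at key
      linarith
    · have hgc : discNorm g x (dist c x) = ‖g.eval x‖ := by
        refine discNorm_eq_norm_eval fun α hα => ?_
        by_contra! hlt'
        refine hne ⟨α, ?_⟩
        simp only [P, Finset.mem_filter, Multiset.mem_toFinset]
        exact ⟨hα, hlt'.trans (dist_comm x c ▸ hcρ)⟩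
      have hgc' : ‖g.eval c‖ = ‖g.eval x‖ := by
        rw [norm_eval_eq_discNorm (a := x), hgc]
        intro α hα heq'
        refine hne ⟨α, ?_⟩
        simp only [P, Finset.mem_filter, Multiset.mem_toFinset]
        exact ⟨hα, heq' ▸ (dist_comm x c ▸ hcρ)⟩
      have h2 := hlt _ dist_nonneg (dist_comm x c ▸ hcρ)
      rw [hgc, ← hgc'] at h2
      have := norm_eval_le_discNorm f (le_refl (dist c x))
      linarith
  have hD := countP_critPoly_ball h0 h1 hd le_rfl hdeg.le hf hg hρ heq
    ⟨0, le_rfl, hρ, fun s hs => hlt s hs.le⟩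
  have hB : ∀ B ∈ 𝓑, (critPoly f g).roots.countP (· ∈ B) + 1 =
      f.roots.countP (· ∈ B) + g.roots.countP (· ∈ B) := by
    intro B hB
    obtain ⟨b, hb, rfl⟩ := Finset.mem_image.1 hB
    obtain ⟨hb1, hb2⟩ := hP b hb
    have := countP_critPoly_closedBall h0 h1 hd le_rfl hdeg.le hf hg (hσ0 b hb1 hb2)
      (hσeq b hb1 hb2) (hσx b hb1 hb2) (hσlt b hb1 hb2)
    have hc : ∀ R : Multiset L, R.countP (· ∈ Metric.closedBall b (σ b)) =
        R.countP (fun α => dist b α ≤ σ b) := by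
      intro R
      refine Multiset.countP_congr rfl fun α _ => propext ?_
      rw [Metric.mem_closedBall, dist_comm]
    rw [hc, hc, hc, this]
  have hsum := Finset.sum_congr rfl hB
  rw [Finset.sum_add_distrib, Finset.sum_add_distrib, sum_countP_mem_eq _ _ hdisj hUq,
    sum_countP_mem_eq _ _ hdisj hUq, sum_countP_mem_eq _ _ hdisj hUq, Finset.sum_const, smul_eq_mul,
    mul_one] at hsum
  have hfU : f.roots.countP U < f.roots.countP (fun α => dist x α < ρ) :=
    countP_lt_countP (fun α _ => hUD α) ((mem_roots hf).2 hfx) (by simpa using hρ) hUx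
  have hgU : g.roots.countP U ≤ g.roots.countP (fun α => dist x α < ρ) :=
    countP_le_countP fun α _ => hUD α
  have hWU' : (critPoly f g).roots.countP (fun α => dist x α < ρ) ≤
      (critPoly f g).roots.countP U := countP_le_countP hWU
  -- Write D for the ball and k for the number of pole discs, with union U. Then W_D + 1 = f_D + g_D
  -- ≥ f_U + 1 + g_U = W_U + k + 1 ≥ W_D + k + 1, where f_U < f_D because x is not in U. So k = 0,
  -- no critical point remains, and f_D + g_D = 1.
  have hcard : 𝓑.card = 0 := by omega
  have hWU0 : (critPoly f g).roots.countP U = 0 := by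
    rw [Multiset.countP_eq_zero]
    rintro α - ⟨B, hB, -⟩
    rw [Finset.card_eq_zero.1 hcard] at hB
    exact absurd hB (Finset.notMem_empty _)
  exact ⟨ρ, hρ, heq, by omega, by omega⟩

lemma norm_eval_eq_of_dist_lt {h : L[X]} {x z : L} {ρ : ℝ} (hR : ∀ α ∈ h.roots, ρ ≤ dist x α)
    (hz : dist z x < ρ) : ‖h.eval z‖ = ‖h.eval x‖ := by
  rw [norm_eval_eq_discNorm (a := x) fun α hα => (hz.trans_le (hR α hα)).ne]
  exact discNorm_eq_norm_eval fun α hα => (hz.trans_le (hR α hα)).le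

/-- On the component around `x` of the preimage of a disc without critical values, `f / g` scales
distances to `x` by its derivative. -/
lemma norm_eval_mul_of_no_critical {f g : L[X]} {π : L} (h0 : π ≠ 0) (h1 : ‖π‖ < 1)
    (hd : ∀ m : ℕ, 1 ≤ m → m ≤ f.natDegree → ‖(m : L)‖ = 1) (hdeg : g.natDegree < f.natDegree)
    (hcop : ∀ z, f.eval z = 0 → g.eval z ≠ 0) (hW : critPoly f g ≠ 0)
    {x : L} (hfx : f.eval x = 0) {r : ℝ} (hr : 0 < r)
    (hcrit : ∀ c, (critPoly f g).eval c = 0 → r * ‖g.eval c‖ ≤ ‖f.eval c‖) {z : L}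
    (hz : ‖f.derivative.eval x‖ * ‖z - x‖ < r * ‖g.eval x‖) :
    g.eval z ≠ 0 ∧
      ‖f.eval z‖ * ‖g.eval x‖ = ‖f.derivative.eval x‖ * ‖z - x‖ * ‖g.eval z‖ := by
  obtain ⟨ρ, hρ, heq, hcf, hcg⟩ := exists_disc_of_no_critical h0 h1 hd hdeg hcop hW hfx hr hcrit
  have hf : f ≠ 0 := by rintro rfl; simp at hdeg
  have hgx : g.eval x ≠ 0 := hcop x hfx
  obtain ⟨h, rfl⟩ := dvd_iff_isRoot.2 hfx
  have hh : h ≠ 0 := right_ne_zero_of_mul hf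
  rw [roots_mul hf, roots_X_sub_C, Multiset.countP_add] at hcf
  have hc1 : ({x} : Multiset L).countP (fun α => dist x α < ρ) = 1 := by
    rw [Multiset.countP_eq_card.2]
    · simp
    · simpa using hρ
  have hRh : ∀ α ∈ h.roots, ρ ≤ dist x α := by
    have : h.roots.countP (fun α => dist x α < ρ) = 0 := by omega
    simpa [Multiset.countP_eq_zero] using this
  have hRg : ∀ α ∈ g.roots, ρ ≤ dist x α := by
    simpa [Multiset.countP_eq_zero] using hcg
  have hder : (derivative ((X - C x) * h)).eval x = h.eval x := by simp
  -- As h and g have no zero in the ball, their norms are constant there. So ρ|h(x)| = r|g(x)|, and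
  -- the hypothesis on z just says |z - x| < ρ.
  have hf1 : discNorm ((X - C x) * h) x ρ = ρ * ‖h.eval x‖ := by
    rw [← discNorm_eq_norm_eval hRh, discNorm, discNorm, leadingCoeff_mul, roots_mul hf]
    simp [hρ.le]
    ring
  rw [hf1, discNorm_eq_norm_eval hRg] at heq
  rw [hder] at hz ⊢
  have hhx : h.eval x ≠ 0 := by
    intro hx
    have := hRh x ((mem_roots hh).2 hx)
    simp at this
    linarith
  have hzρ : dist z x < ρ := by
    rw [← heq, mul_comm, ← dist_eq_norm] at hz
    exact lt_of_mul_lt_mul_right hz (norm_nonneg _)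
  have eg := norm_eval_eq_of_dist_lt hRg hzρ
  have eh := norm_eval_eq_of_dist_lt hRh hzρ
  refine ⟨by rw [← norm_pos_iff, eg]; exact norm_pos_iff.2 hgx, ?_⟩
  rw [eval_mul, norm_mul, eh, eg, eval_sub, eval_X, eval_C]
  ring

end Pullback

/-! ### Tame maps fixing ∞ and their critical points -/

section Dynamics

variable {L : Type*} [NormedField L]

/-- The map `z ↦ f(z) / g(z)`. -/
noncomputable def quotMap {F : Type*} [Field F] (f g : F[X]) (z : F) : F := f.eval z / g.eval z

/-- The derivative of `f / g` at `z`. -/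
noncomputable def quotDeriv {F : Type*} [Field F] (f g : F[X]) (z : F) : F :=
  (critPoly f g).eval z / g.eval z ^ 2

/-- A rational function `f / g` fixing `∞` whose degree is at least two and less than the residue
characteristic. -/
structure IsTame (f g : L[X]) : Prop where
  natDegree_lt : g.natDegree < f.natDegree
  two_le : 2 ≤ f.natDegree
  norm_natCast : ∀ m : ℕ, 1 ≤ m → m ≤ f.natDegree → ‖(m : L)‖ = 1
  isCoprime : IsCoprime f g

namespace IsTame

variable {f g : L[X]}

lemma eval_ne_zero (h : IsTame f g) {z : L} (hz : f.eval z = 0) : g.eval z ≠ 0 := by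
  obtain ⟨a, b, hab⟩ := h.isCoprime
  intro hg
  have := congrArg (eval z) hab
  simp [hz, hg] at this

lemma ne_zero (h : IsTame f g) : f ≠ 0 := by
  rintro rfl
  have := h.two_le
  simp at this

/-- If f'g = fg', coprimality gives f ∣ f', so f' = 0 by degree; but its coefficient of degree deg f
- 1 is deg f times the leading coefficient of f, and |deg f| = 1. -/
lemma critPoly_ne_zero (h : IsTame f g) : critPoly f g ≠ 0 := by
  intro hW
  have h1 : f ∣ derivative f * g := ⟨derivative g, sub_eq_zero.1 hW⟩
  have h2 : f ∣ derivative f := h.isCoprime.dvd_of_dvd_mul_right h1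
  have hd := h.two_le
  have h3 : derivative f = 0 :=
    eq_zero_of_dvd_of_natDegree_lt h2 (natDegree_derivative_lt (by omega))
  have h4 := congrArg (fun p => p.coeff (f.natDegree - 1)) h3
  simp only [coeff_derivative, coeff_zero] at h4
  rw [Nat.sub_add_cancel (by omega), coeff_natDegree, mul_eq_zero] at h4
  rcases h4 with h4 | h4
  · exact h.ne_zero (leadingCoeff_eq_zero.1 h4)
  · have := h.norm_natCast f.natDegree (by omega) le_rfl
    rw [← Nat.cast_add_one, Nat.sub_add_cancel (by omega)] at h4
    rw [h4, norm_zero] at this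
    exact zero_ne_one this

/-- The source of 2d - 2: differentiation lowers the degree by one, and deg g ≤ d - 1 because ∞ is
fixed. -/
lemma natDegree_critPoly_le (h : IsTame f g) : (critPoly f g).natDegree ≤ 2 * f.natDegree - 2 := by
  have h1 := h.natDegree_lt
  have h2 := h.two_le
  refine (natDegree_sub_le _ _).trans (max_le ?_ ?_)
  · refine natDegree_mul_le.trans ?_
    have := natDegree_derivative_le f
    omega
  · by_cases hg : g.natDegree = 0
    · rw [derivative_of_natDegree_zero hg, mul_zero, natDegree_zero]
      omega
    · refine natDegree_mul_le.trans ?_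
      have := natDegree_derivative_lt hg
      omega

lemma natDegree_sub_C_mul (h : IsTame f g) (y : L) : (f - C y * g).natDegree = f.natDegree :=
  natDegree_sub_eq_left_of_natDegree_lt ((natDegree_C_mul_le y g).trans_lt h.natDegree_lt)

/-- Subtracting a constant from f/g moves any value to 0 without changing the critical points, so
results about zeros of f apply to every fibre. -/
lemma sub_C_mul (h : IsTame f g) (y : L) : IsTame (f - C y * g) g where
  natDegree_lt := by rw [h.natDegree_sub_C_mul]; exact h.natDegree_lt
  two_le := by rw [h.natDegree_sub_C_mul]; exact h.two_le
  norm_natCast := by rw [h.natDegree_sub_C_mul]; exact h.norm_natCast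
  isCoprime := by
    have := (IsCoprime.add_mul_right_left_iff (z := -C y)).2 h.isCoprime
    rwa [neg_mul, ← sub_eq_add_neg] at this

end IsTame

lemma critPoly_sub_C_mul {F : Type*} [Field F] (f g : F[X]) (y : F) :
    critPoly (f - C y * g) g = critPoly f g := by
  simp only [critPoly, derivative_sub, derivative_mul, derivative_C]
  ring

lemma eval_sub_C_mul {F : Type*} [Field F] {f g : F[X]} (y : F) {z : F} (hz : g.eval z ≠ 0) :
    (f - C y * g).eval z = (quotMap f g z - y) * g.eval z := by
  simp only [quotMap, eval_sub, eval_mul, eval_C]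
  field_simp

lemma eval_derivative_sub_C_mul {F : Type*} [Field F] {f g : F[X]} {x : F} (hx : g.eval x ≠ 0) :
    (derivative (f - C (quotMap f g x) * g)).eval x = quotDeriv f g x * g.eval x := by
  simp only [quotMap, quotDeriv, critPoly, derivative_sub, derivative_mul, derivative_C, eval_sub,
    eval_mul, eval_add, eval_C, zero_mul, eval_zero]
  field_simp
  ring

lemma exists_pos_le_dist (R : Multiset L) {x : L} (hx : x ∉ R) :
    ∃ δ : ℝ, 0 < δ ∧ ∀ α ∈ R, δ ≤ dist x α := by
  induction R using Multiset.induction_on with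
  | empty => exact ⟨1, one_pos, by simp⟩
  | cons β R ih =>
    rw [Multiset.mem_cons, not_or] at hx
    obtain ⟨δ, hδ, hR⟩ := ih hx.2
    refine ⟨min δ (dist x β), lt_min hδ (dist_pos.2 hx.1), fun α hα => ?_⟩
    rcases Multiset.mem_cons.1 hα with rfl | hα
    · exact min_le_right _ _
    · exact (min_le_left _ _).trans (hR α hα)

section

variable [IsUltrametricDist L] [IsAlgClosed L] {f g : L[X]}

lemma IsTame.norm_quotMap_sub_of_no_critical (h : IsTame f g) {π : L} (h0 : π ≠ 0) (h1 : ‖π‖ < 1)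
    {x : L} (hx : g.eval x ≠ 0) {R : ℝ} (hR : 0 < R)
    (hcrit : ∀ c, (critPoly f g).eval c = 0 → g.eval c ≠ 0 →
      R ≤ ‖quotMap f g c - quotMap f g x‖)
    {z : L} (hz : ‖quotDeriv f g x‖ * ‖z - x‖ < R) :
    g.eval z ≠ 0 ∧ ‖quotMap f g z - quotMap f g x‖ = ‖quotDeriv f g x‖ * ‖z - x‖ := by
  have h' := h.sub_C_mul (quotMap f g x)
  have hgx : 0 < ‖g.eval x‖ := norm_pos_iff.2 hx
  have key := norm_eval_mul_of_no_critical h0 h1 h'.norm_natCast h'.natDegree_lt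
    (fun z => h'.eval_ne_zero) h'.critPoly_ne_zero (x := x) (r := R) (z := z)
    (by rw [eval_sub_C_mul _ hx, sub_self, zero_mul]) hR ?_ ?_
  · obtain ⟨hgz, key⟩ := key
    refine ⟨hgz, ?_⟩
    rw [eval_sub_C_mul _ hgz, eval_derivative_sub_C_mul hx, norm_mul, norm_mul] at key
    have : 0 < ‖g.eval z‖ := norm_pos_iff.2 hgz
    refine mul_right_cancel₀ (mul_pos this hgx).ne' ?_
    linarith
  · intro c hc
    rw [critPoly_sub_C_mul] at hc
    by_cases hgc : g.eval c = 0
    -- A critical point that is a pole satisfies the required bound trivially.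
    · rw [hgc, norm_zero, mul_zero]; exact norm_nonneg _
    · rw [eval_sub_C_mul _ hgc, norm_mul]
      gcongr
      exact hcrit c hc hgc
  · rw [eval_derivative_sub_C_mul hx, norm_mul]
    calc ‖quotDeriv f g x‖ * ‖g.eval x‖ * ‖z - x‖
        = (‖quotDeriv f g x‖ * ‖z - x‖) * ‖g.eval x‖ := by ring
      _ < R * ‖g.eval x‖ := by gcongr

/-- Near a point that is not critical, `f / g` scales distances by its derivative. -/
lemma exists_norm_quotMap_sub_eq {x : L} (hx : g.eval x ≠ 0) (hq : quotDeriv f g x ≠ 0) :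
    ∃ δ : ℝ, 0 < δ ∧ ∀ z, ‖z - x‖ < δ → g.eval z ≠ 0 ∧
      ‖quotMap f g z - quotMap f g x‖ = ‖quotDeriv f g x‖ * ‖z - x‖ := by
  have hroot : (f - C (quotMap f g x) * g).eval x = 0 := by
    rw [eval_sub_C_mul _ hx, sub_self, zero_mul]
  obtain ⟨h, hh⟩ := dvd_iff_isRoot.2 hroot
  have hder := eval_derivative_sub_C_mul (f := f) hx
  rw [hh] at hder
  simp only [derivative_mul, derivative_sub, derivative_X, derivative_C, sub_zero, one_mul,
    eval_add, eval_mul, eval_sub, eval_X, eval_C, sub_self, zero_mul, add_zero] at hder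
  have hhx : h.eval x ≠ 0 := by rw [hder]; exact mul_ne_zero hq hx
  have hnot : ∀ p : L[X], p.eval x ≠ 0 → x ∉ p.roots := fun p hp hmem =>
    hp (isRoot_of_mem_roots hmem)
  obtain ⟨δ₁, hδ₁, hR₁⟩ := exists_pos_le_dist _ (hnot h hhx)
  obtain ⟨δ₂, hδ₂, hR₂⟩ := exists_pos_le_dist _ (hnot g hx)
  refine ⟨min δ₁ δ₂, lt_min hδ₁ hδ₂, fun z hz => ?_⟩
  rw [← dist_eq_norm] at hz
  have eh := norm_eval_eq_of_dist_lt hR₁ (hz.trans_le (min_le_left _ _))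
  have eg := norm_eval_eq_of_dist_lt hR₂ (hz.trans_le (min_le_right _ _))
  have hgx : 0 < ‖g.eval x‖ := norm_pos_iff.2 hx
  have hgz : g.eval z ≠ 0 := by rw [← norm_pos_iff, eg]; exact hgx
  refine ⟨hgz, ?_⟩
  have := eval_sub_C_mul (f := f) (quotMap f g x) hgz
  rw [hh, eval_mul, eval_sub, eval_X, eval_C] at this
  have := congrArg norm this
  rw [norm_mul, norm_mul, eh, hder, norm_mul, eg] at this
  refine mul_right_cancel₀ hgx.ne' ?_
  linarith

end

/-- The orbit of `c` under `F` accumulates only at the orbit of `x`. -/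
def IsAttractedTo (F : L → L) (c x : L) : Prop :=
  ∀ ε : ℝ, 0 < ε → ∃ N : ℕ, ∀ m, N ≤ m → ∃ i, ‖F^[m] c - F^[i] x‖ < ε

lemma IsAttractedTo.of_map {F : L → L} {c x : L} (h : IsAttractedTo F (F c) x) :
    IsAttractedTo F c x := by
  intro ε hε
  obtain ⟨N, hN⟩ := h ε hε
  refine ⟨N + 1, fun m hm => ?_⟩
  obtain ⟨m, rfl⟩ := Nat.exists_eq_add_of_le' (le_of_add_le_right hm)
  exact hN m (by omega)

/-- Two disjoint periodic orbits have a positive distance δ, and a late iterate of c within δ of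
both would violate the ultrametric inequality. Here F is arbitrary, so the value 0 that `quotMap`
takes at poles does no harm. -/
lemma IsAttractedTo.exists_iterate_eq [IsUltrametricDist L] {F : L → L} {c x x' : L} {n n' : ℕ}
    (hn : 0 < n) (hn' : 0 < n') (hx : F.IsPeriodicPt n x) (hx' : F.IsPeriodicPt n' x')
    (h : IsAttractedTo F c x) (h' : IsAttractedTo F c x') : ∃ k, F^[k] x = x' := by
  by_contra! hne
  have hne2 : ∀ i j, F^[i] x ≠ F^[j] x' := by
    intro i j hij
    refine hne (n' - j % n' + i) ?_
    rw [Function.iterate_add_apply, hij, ← hx'.iterate_mod_apply j, ← Function.iterate_add_apply,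
      Nat.sub_add_cancel (Nat.mod_lt _ hn').le]
    exact hx'
  have hnon : (Finset.range n ×ˢ Finset.range n').Nonempty :=
    ⟨(0, 0), by simp [hn, hn']⟩
  obtain ⟨⟨i₀, j₀⟩, -, hmin⟩ := Finset.exists_min_image _
    (fun p : ℕ × ℕ => ‖F^[p.1] x - F^[p.2] x'‖) hnon
  have hδ : 0 < ‖F^[i₀] x - F^[j₀] x'‖ := norm_pos_iff.2 (sub_ne_zero.2 (hne2 _ _))
  obtain ⟨N, hN⟩ := h _ hδ
  obtain ⟨N', hN'⟩ := h' _ hδ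
  obtain ⟨i, hi⟩ := hN (max N N') (le_max_left _ _)
  obtain ⟨j, hj⟩ := hN' (max N N') (le_max_right _ _)
  have h1 := hmin (i % n, j % n') (by simp [Nat.mod_lt, hn, hn'])
  simp only [hx.iterate_mod_apply, hx'.iterate_mod_apply] at h1
  have h2 : F^[i] x - F^[j] x' =
      -(F^[max N N'] c - F^[i] x) + (F^[max N N'] c - F^[j] x') := by ring
  have h3 := IsUltrametricDist.norm_add_le_max (-(F^[max N N'] c - F^[i] x))
    (F^[max N N'] c - F^[j] x')
  rw [← h2, norm_neg] at h3
  exact absurd (h1.trans h3) (not_le.2 (max_lt hi hj))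

/-! ### Every attracting cycle attracts a critical point -/

section Cycle

variable [IsUltrametricDist L] [IsAlgClosed L] {f g : L[X]} {x : L} {n : ℕ}

/-- The product of the absolute values of the first `i` derivatives along the orbit of `x`. -/
noncomputable def derivProd (f g : L[X]) (x : L) (i : ℕ) : ℝ :=
  ∏ j ∈ Finset.range i, ‖quotDeriv f g ((quotMap f g)^[j] x)‖

omit [IsUltrametricDist L] [IsAlgClosed L] in
lemma derivProd_succ (i : ℕ) :
    derivProd f g x (i + 1) = derivProd f g x i * ‖quotDeriv f g ((quotMap f g)^[i] x)‖ :=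
  Finset.prod_range_succ _ _

omit [IsUltrametricDist L] [IsAlgClosed L] in
lemma derivProd_mul_add (hx : (quotMap f g).IsPeriodicPt n x) (k j : ℕ) :
    derivProd f g x (n * k + j) = derivProd f g x n ^ k * derivProd f g x j := by
  have hadd : ∀ m, derivProd f g x (n + m) = derivProd f g x n * derivProd f g x m := by
    intro m
    rw [derivProd, Finset.prod_range_add]
    congr 1
    refine Finset.prod_congr rfl fun i _ => ?_
    rw [add_comm n i, Function.iterate_add_apply, hx.eq]
  induction k with
  | zero => simp
  | succ k ih => rw [mul_add, mul_one, add_comm (n * k), add_assoc, hadd, ih]; ring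

/-- On the disc of radius `R` around the `i`-th point of the orbit of `x`, all iterates of `f / g`
scale distances by the derivative. -/
def ScalesOn (f g : L[X]) (x : L) (i : ℕ) (R : ℝ) : Prop :=
  ∀ z, ‖z - (quotMap f g)^[i] x‖ < R → g.eval z ≠ 0 ∧
    ∀ j, ‖(quotMap f g)^[j] z - (quotMap f g)^[i + j] x‖ * derivProd f g x i =
      derivProd f g x (i + j) * ‖z - (quotMap f g)^[i] x‖

omit [IsUltrametricDist L] [IsAlgClosed L] in
-- Every full turn contributes the absolute value of the multiplier; the remaining partial turn is
-- bounded by M.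
lemma exists_derivProd_le (hn : 0 < n) (hx : (quotMap f g).IsPeriodicPt n x) :
    ∃ M, 0 < M ∧ ∀ i, derivProd f g x i ≤ derivProd f g x n ^ (i / n) * M := by
  refine ⟨1 + ∑ j ∈ Finset.range n, derivProd f g x j, ?_, fun i => ?_⟩
  · have : ∀ j, 0 ≤ derivProd f g x j := fun j => Finset.prod_nonneg fun _ _ => norm_nonneg _
    have := Finset.sum_nonneg fun j (_ : j ∈ Finset.range n) => this j
    linarith
  · have h0 : ∀ j, 0 ≤ derivProd f g x j := fun j => Finset.prod_nonneg fun _ _ => norm_nonneg _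
    conv_lhs => rw [← Nat.div_add_mod i n, derivProd_mul_add hx]
    have := Finset.single_le_sum (fun j _ => h0 j) (Finset.mem_range.2 (Nat.mod_lt i hn))
    have hp := h0 n
    gcongr
    linarith

omit [IsUltrametricDist L] [IsAlgClosed L] in
lemma derivProd_lt_of_large (hn : 0 < n) (hx : (quotMap f g).IsPeriodicPt n x)
    (hl : derivProd f g x n < 1) {ε : ℝ} (hε : 0 < ε) :
    ∃ N, ∀ m, N ≤ m → derivProd f g x m < ε := by
  obtain ⟨M, hM, hb⟩ := exists_derivProd_le hn hx
  obtain ⟨k, hk⟩ := exists_pow_lt_of_lt_one (div_pos hε hM) hl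
  have h0 : 0 ≤ derivProd f g x n := Finset.prod_nonneg fun _ _ => norm_nonneg _
  refine ⟨k * n, fun m hm => (hb m).trans_lt ?_⟩
  rw [← lt_div_iff₀ hM]
  exact (pow_le_pow_of_le_one h0 hl.le ((Nat.le_div_iff_mul_le hn).2 hm)).trans_lt hk

omit [IsUltrametricDist L] [IsAlgClosed L] in
lemma ScalesOn.isAttractedTo (hn : 0 < n) (hx : (quotMap f g).IsPeriodicPt n x)
    (hl : derivProd f g x n < 1) {i : ℕ} (hi : 0 < derivProd f g x i) {R : ℝ}
    (h : ScalesOn f g x i R) {z : L} (hz : ‖z - (quotMap f g)^[i] x‖ < R) :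
    IsAttractedTo (quotMap f g) z x := by
  intro ε hε
  have hR : 0 < R := (norm_nonneg _).trans_lt hz
  obtain ⟨N, hN⟩ := derivProd_lt_of_large hn hx hl (ε := ε * derivProd f g x i / R) (by positivity)
  refine ⟨N, fun m hm => ⟨i + m, ?_⟩⟩
  have h1 := (h z hz).2 m
  have h2 := hN (i + m) (by omega)
  rw [lt_div_iff₀ hR] at h2
  refine lt_of_mul_lt_mul_right ?_ hi.le
  rw [h1]
  refine lt_of_le_of_lt ?_ h2
  have : 0 ≤ derivProd f g x (i + m) := Finset.prod_nonneg fun _ _ => norm_nonneg _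
  gcongr

/-- The cycle is finite, so one radius serves at all its points. Dividing it by a bound M for the
derivative products keeps the whole orbit of z within reach of the local scaling. -/
lemma exists_scalesOn_zero (hn : 0 < n) (hx : (quotMap f g).IsPeriodicPt n x)
    (hl : derivProd f g x n < 1) (hg : ∀ i, g.eval ((quotMap f g)^[i] x) ≠ 0)
    (hq : ∀ i, quotDeriv f g ((quotMap f g)^[i] x) ≠ 0) : ∃ r, 0 < r ∧ ScalesOn f g x 0 r := by
  choose δ hδ hδ' using fun i => exists_norm_quotMap_sub_eq (hg i) (hq i)
  obtain ⟨i₀, -, hmin⟩ := (Finset.range n).exists_min_image δ ⟨0, Finset.mem_range.2 hn⟩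
  have hloc : ∀ i z, ‖z - (quotMap f g)^[i] x‖ < δ i₀ → g.eval z ≠ 0 ∧
      ‖quotMap f g z - (quotMap f g)^[i + 1] x‖ =
        ‖quotDeriv f g ((quotMap f g)^[i] x)‖ * ‖z - (quotMap f g)^[i] x‖ := by
    intro i z hz
    have := hδ' (i % n) z
    rw [hx.iterate_mod_apply] at this
    rw [Function.iterate_succ_apply']
    exact this (hz.trans_le (hmin _ (Finset.mem_range.2 (Nat.mod_lt _ hn))))
  obtain ⟨M, hM, hb⟩ := exists_derivProd_le hn hx
  have h0 : ∀ i, 0 ≤ derivProd f g x i := fun i => Finset.prod_nonneg fun _ _ => norm_nonneg _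
  have hb' : ∀ i, derivProd f g x i ≤ M := fun i => (hb i).trans
    (mul_le_of_le_one_left hM.le (pow_le_one₀ (h0 n) hl.le))
  have hP0 : derivProd f g x 0 = 1 := by simp [derivProd]
  have h1M : 1 ≤ M := hP0 ▸ hb' 0
  refine ⟨δ i₀ / M, div_pos (hδ _) hM, fun z hz => ?_⟩
  rw [Function.iterate_zero_apply] at hz
  have hz' : ‖z - x‖ < δ i₀ := hz.trans_le (div_le_self (hδ _).le h1M)
  refine ⟨(hloc 0 z (by simpa using hz')).1, fun j => ?_⟩
  rw [zero_add, hP0, mul_one, Function.iterate_zero_apply]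
  induction j with
  | zero => simp [hP0]
  | succ j ih =>
    rw [Function.iterate_succ_apply', (hloc j _ ?_).2, ih, derivProd_succ]
    · ring
    · rw [ih]
      rw [lt_div_iff₀ hM] at hz
      calc derivProd f g x j * ‖z - x‖ ≤ M * ‖z - x‖ := by gcongr; exact hb' j
        _ < δ i₀ := by linarith

/-- A scaling disc can be pulled back along the orbit when no critical point is attracted. -/
lemma IsTame.scalesOn_pred (h : IsTame f g) {π : L} (h0 : π ≠ 0) (h1 : ‖π‖ < 1) (hn : 0 < n)
    (hx : (quotMap f g).IsPeriodicPt n x) (hl : derivProd f g x n < 1)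
    (hg : ∀ i, g.eval ((quotMap f g)^[i] x) ≠ 0)
    (hq : ∀ i, quotDeriv f g ((quotMap f g)^[i] x) ≠ 0)
    (hcrit : ∀ c, (critPoly f g).eval c = 0 → ¬ IsAttractedTo (quotMap f g) c x)
    {i : ℕ} {R : ℝ} (hR : 0 < R) (hs : ScalesOn f g x (i + 1) R) :
    ScalesOn f g x i (R / ‖quotDeriv f g ((quotMap f g)^[i] x)‖) := by
  have hqi : 0 < ‖quotDeriv f g ((quotMap f g)^[i] x)‖ := norm_pos_iff.2 (hq i)
  have hP : 0 < derivProd f g x (i + 1) := Finset.prod_pos fun j _ => norm_pos_iff.2 (hq j)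
  intro z hz
  rw [lt_div_iff₀ hqi] at hz
  -- A critical value in the scaling disc would be drawn to the cycle, and its critical point with
  -- it.
  have hcrit' : ∀ c, (critPoly f g).eval c = 0 → g.eval c ≠ 0 →
      R ≤ ‖quotMap f g c - quotMap f g ((quotMap f g)^[i] x)‖ := by
    intro c hc _
    by_contra! hlt
    rw [← Function.iterate_succ_apply' (quotMap f g)] at hlt
    exact hcrit c hc (hs.isAttractedTo hn hx hl hP hlt).of_map
  obtain ⟨hgz, hz1⟩ := h.norm_quotMap_sub_of_no_critical h0 h1 (hg i) hR hcrit' (z := z)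
    (by linarith)
  refine ⟨hgz, fun j => ?_⟩
  cases j with
  | zero => simp [mul_comm]
  | succ j =>
    rw [← Function.iterate_succ_apply' (quotMap f g)] at hz1
    have := (hs (quotMap f g z) (by rw [hz1]; linarith)).2 j
    rw [hz1, derivProd_succ] at this
    rw [Function.iterate_succ_apply]
    refine mul_right_cancel₀ hqi.ne' ?_
    rw [show i + (j + 1) = i + 1 + j by omega]
    linarith

/-- Every attracting cycle attracts a critical point. -/
theorem IsTame.exists_critical_isAttractedTo (h : IsTame f g) (hn : 0 < n)
    (hx : (quotMap f g).IsPeriodicPt n x) (hg : ∀ i, g.eval ((quotMap f g)^[i] x) ≠ 0)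
    (hl : ‖∏ i ∈ Finset.range n, quotDeriv f g ((quotMap f g)^[i] x)‖ < 1) :
    ∃ c, (critPoly f g).eval c = 0 ∧ IsAttractedTo (quotMap f g) c x := by
  -- If λ = 0, the cycle contains a critical point, which is attracted trivially.
  by_cases hq : ∃ i, quotDeriv f g ((quotMap f g)^[i] x) = 0
  · obtain ⟨i, hi⟩ := hq
    refine ⟨_, (div_eq_zero_iff.1 hi).resolve_right (pow_ne_zero 2 (hg i)), fun ε hε => ?_⟩
    refine ⟨0, fun m _ => ⟨m + i, ?_⟩⟩
    rwa [Function.iterate_add_apply, sub_self, norm_zero]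
  push Not at hq
  by_contra! hcrit
  -- The multiplier itself is the element with 0 < |π| < 1 that the counting lemmas need.
  set π := ∏ i ∈ Finset.range n, quotDeriv f g ((quotMap f g)^[i] x)
  have h0 : π ≠ 0 := Finset.prod_ne_zero_iff.2 fun i _ => hq i
  have hπ : derivProd f g x n = ‖π‖ := (norm_prod _ _).symm
  rw [← hπ] at hl
  obtain ⟨r, hr, hs⟩ := exists_scalesOn_zero hn hx hl hg hq
  have hpos : ∀ i, 0 < derivProd f g x i := fun i =>
    Finset.prod_pos fun j _ => norm_pos_iff.2 (hq j)
  have hback : ∀ m R, 0 < R → ScalesOn f g x m R → ScalesOn f g x 0 (R / derivProd f g x m) := by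
    intro m
    induction m with
    | zero => intro R _ h; simpa [derivProd] using h
    | succ m ih =>
      intro R hR hm
      have := ih _ (div_pos hR (norm_pos_iff.2 (hq m)))
        (h.scalesOn_pred h0 (hπ ▸ hl) hn hx hl hg hq hcrit hR hm)
      rwa [div_div, mul_comm, ← derivProd_succ] at this
  have hall : ∀ z, g.eval z ≠ 0 ∧
      ‖quotMap f g z - quotMap f g x‖ = ‖quotDeriv f g x‖ * ‖z - x‖ := by
    intro z
    obtain ⟨N, hN⟩ := derivProd_lt_of_large hn hx hl (ε := r / (‖z - x‖ + 1)) (by positivity)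
    have hper : (quotMap f g)^[n * N] x = x := hx.mul_const N
    -- After N turns the orbit is back at x, so the same disc scales there; pulling it back gives
    -- radius r/|λ|^N, large enough to contain z.
    have hsN : ScalesOn f g x (n * N) r := by
      intro w hw
      rw [hper] at hw
      obtain ⟨hw1, hw2⟩ := hs w hw
      refine ⟨hw1, fun j => ?_⟩
      have := hw2 j
      rw [zero_add, Function.iterate_zero_apply] at this
      have e1 : derivProd f g x (n * N) = derivProd f g x n ^ N := by
        have := derivProd_mul_add hx N 0
        simpa [derivProd] using this
      rw [add_comm (n * N) j, Function.iterate_add_apply, hper, add_comm j,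
        derivProd_mul_add hx, e1]
      simp only [derivProd, Finset.range_zero, Finset.prod_empty, mul_one] at this ⊢
      rw [this]
      ring
    have hsz := hback _ _ hr hsN z (by
      rw [Function.iterate_zero_apply, lt_div_iff₀ (hpos _)]
      have h1 := hN (n * N) (Nat.le_mul_of_pos_left _ hn)
      rw [lt_div_iff₀ (by positivity)] at h1
      have := hpos (n * N)
      nlinarith)
    refine ⟨hsz.1, ?_⟩
    have := hsz.2 1
    simpa [derivProd] using this
  -- By the global scaling, x is the only root of p, hence of multiplicity d ≥ 2, whereas p'(x) ≠ 0.
  set p := f - C (quotMap f g x) * g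
  have hp := h.sub_C_mul (quotMap f g x)
  have hgx := (hall x).1
  have hroot : ∀ z ∈ p.roots, z = x := by
    intro z hz
    have h1 : p.eval z = 0 := isRoot_of_mem_roots hz
    rw [eval_sub_C_mul _ (hall z).1, mul_eq_zero, or_iff_left (hall z).1] at h1
    have h2 := (hall z).2
    rw [h1, norm_zero, eq_comm, mul_eq_zero, norm_eq_zero,
      or_iff_right (show quotDeriv f g x ≠ 0 from hq 0), norm_eq_zero] at h2
    exact sub_eq_zero.1 h2
  have hcount : 1 < p.rootMultiplicity x := by
    classical
    rw [← count_roots, Multiset.count_eq_card.2 fun z hz => (hroot z hz).symm,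
      ← (IsAlgClosed.splits p).natDegree_eq_card_roots]
    exact hp.two_le
  have := ((one_lt_rootMultiplicity_iff_isRoot hp.ne_zero).1 hcount).2
  rw [IsRoot, eval_derivative_sub_C_mul hgx] at this
  exact mul_ne_zero (hq 0) hgx this

/-- The number of attracting cycles of a tame rational function fixing `∞`, none of which passes
through `∞`, is at most the number of critical points. -/
theorem IsTame.card_attracting_le (h : IsTame f g) {ι : Type*} (y : ι → L) (n : ι → ℕ)
    (hn : ∀ a, 0 < n a) (hper : ∀ a, (quotMap f g).IsPeriodicPt (n a) (y a))
    (hg : ∀ a i, g.eval ((quotMap f g)^[i] (y a)) ≠ 0)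
    (hl : ∀ a, ‖∏ i ∈ Finset.range (n a), quotDeriv f g ((quotMap f g)^[i] (y a))‖ < 1)
    (hne : ∀ a b k, (quotMap f g)^[k] (y a) = y b → a = b) :
    ENat.card ι ≤ ((2 * f.natDegree - 2 : ℕ) : ℕ∞) := by
  classical
  choose c hc hc' using fun a => h.exists_critical_isAttractedTo (hn a) (hper a) (hg a) (hl a)
  have hW := h.critPoly_ne_zero
  let Φ : ι → (critPoly f g).roots.toFinset := fun a =>
    ⟨c a, Multiset.mem_toFinset.2 ((mem_roots hW).2 (hc a))⟩
  have hΦ : Function.Injective Φ := by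
    intro a b hab
    have hcab : c a = c b := congrArg Subtype.val hab
    obtain ⟨k, hk⟩ := (hc' a).exists_iterate_eq (hn a) (hn b) (hper a) (hper b) (hcab ▸ hc' b)
    exact hne a b k hk
  refine (ENat.card_le_card_of_injective hΦ).trans ?_
  rw [ENat.card_eq_coe_fintype_card, Fintype.card_coe]
  exact_mod_cast (Multiset.toFinset_card_le _).trans
    ((card_roots' _).trans h.natDegree_critPoly_le)

end Cycle

end Dynamics

/-! ### Values and derivatives of rational functions, with the chain rule -/

section Taylor

variable {F : Type*} [Field F]

/-- The rational function `ψ` is regular at `x`, with value `v` and derivative `e` there. -/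
def HasTaylor (ψ : RatFunc F) (x v e : F) : Prop :=
  ∃ a b : F[X], b.eval x ≠ 0 ∧ ψ = algebraMap F[X] (RatFunc F) a / algebraMap F[X] (RatFunc F) b ∧
    quotMap a b x = v ∧ quotDeriv a b x = e

lemma algebraMap_ne_zero_of_eval {b : F[X]} {x : F} (hb : b.eval x ≠ 0) :
    algebraMap F[X] (RatFunc F) b ≠ 0 := by
  refine RatFunc.algebraMap_ne_zero ?_
  rintro rfl
  simp at hb

lemma hasTaylor_of_denom_ne_zero {ψ : RatFunc F} {x : F} (h : ψ.denom.eval x ≠ 0) :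
    HasTaylor ψ x (ψ.num.eval x / ψ.denom.eval x) (derivAt ψ x) :=
  ⟨ψ.num, ψ.denom, h, (RatFunc.num_div_denom ψ).symm, rfl, by
    simp [quotDeriv, critPoly, derivAt]⟩

namespace HasTaylor

variable {ψ χ : RatFunc F} {x v w e e' : F}

/-- Value and derivative may be computed from any presentation in lowest terms. -/
lemma of_isCoprime {a b : F[X]} (hab : IsCoprime a b) (hb0 : b ≠ 0)
    (h : HasTaylor (algebraMap F[X] (RatFunc F) a / algebraMap F[X] (RatFunc F) b) x v e) :
    b.eval x ≠ 0 ∧ quotMap a b x = v ∧ quotDeriv a b x = e := by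
  obtain ⟨a', b', hb', heq, rfl, rfl⟩ := h
  rw [div_eq_div_iff (RatFunc.algebraMap_ne_zero hb0) (algebraMap_ne_zero_of_eval hb'),
    ← map_mul, ← map_mul, (RatFunc.algebraMap_injective F).eq_iff] at heq
  obtain ⟨k, rfl⟩ : b ∣ b' := hab.symm.dvd_of_dvd_mul_left ⟨a', by rw [heq]; ring⟩
  have ha' : a' = a * k := by
    refine mul_right_cancel₀ hb0 ?_
    rw [← heq]; ring
  subst ha'
  rw [eval_mul] at hb'
  have hb := left_ne_zero_of_mul hb'
  have hk := right_ne_zero_of_mul hb'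
  refine ⟨hb, ?_, ?_⟩
  · simp only [quotMap, eval_mul]
    field_simp
  · simp only [quotDeriv, critPoly, eval_mul, eval_sub, eval_add, derivative_mul]
    field_simp
    ring

lemma num_denom (h : HasTaylor ψ x v e) :
    ψ.denom.eval x ≠ 0 ∧ ψ.num.eval x / ψ.denom.eval x = v ∧ derivAt ψ x = e := by
  rw [← RatFunc.num_div_denom ψ] at h
  obtain ⟨h1, h2, h3⟩ := h.of_isCoprime (RatFunc.isCoprime_num_denom ψ) (RatFunc.denom_ne_zero ψ)
  refine ⟨h1, h2, h3 ▸ ?_⟩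
  simp [quotDeriv, critPoly, derivAt]

lemma derivAt_eq (h : HasTaylor ψ x v e) : derivAt ψ x = e := h.num_denom.2.2

protected lemma const (c x : F) : HasTaylor (RatFunc.C c) x c 0 :=
  ⟨C c, 1, by simp, by simp, by simp [quotMap], by simp [quotDeriv, critPoly]⟩

protected lemma X (x : F) : HasTaylor (RatFunc.X : RatFunc F) x x 1 :=
  ⟨X, 1, by simp, by simp, by simp [quotMap], by simp [quotDeriv, critPoly]⟩

protected lemma add (h : HasTaylor ψ x v e) (h' : HasTaylor χ x w e') :
    HasTaylor (ψ + χ) x (v + w) (e + e') := by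
  obtain ⟨a, b, hb, rfl, rfl, rfl⟩ := h
  obtain ⟨a', b', hb', rfl, rfl, rfl⟩ := h'
  refine ⟨a * b' + b * a', b * b', by simp [hb, hb'], ?_, ?_, ?_⟩
  · rw [div_add_div _ _ (algebraMap_ne_zero_of_eval hb) (algebraMap_ne_zero_of_eval hb')]
    simp only [map_add, map_mul]
  · simp only [quotMap, eval_add, eval_mul]
    field_simp
  · simp only [quotDeriv, critPoly, eval_mul, eval_sub, eval_add, derivative_mul, derivative_add]
    field_simp
    ring

protected lemma mul (h : HasTaylor ψ x v e) (h' : HasTaylor χ x w e') :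
    HasTaylor (ψ * χ) x (v * w) (e * w + v * e') := by
  obtain ⟨a, b, hb, rfl, rfl, rfl⟩ := h
  obtain ⟨a', b', hb', rfl, rfl, rfl⟩ := h'
  refine ⟨a * a', b * b', by simp [hb, hb'], ?_, ?_, ?_⟩
  · rw [div_mul_div_comm]
    simp only [map_mul]
  · simp only [quotMap, eval_mul]
    field_simp
  · simp only [quotMap, quotDeriv, critPoly, eval_mul, eval_sub, eval_add, derivative_mul]
    field_simp
    ring

protected lemma inv (h : HasTaylor ψ x v e) (hv : v ≠ 0) : HasTaylor ψ⁻¹ x v⁻¹ (-e / v ^ 2) := by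
  obtain ⟨a, b, hb, rfl, rfl, rfl⟩ := h
  have ha : a.eval x ≠ 0 := (div_ne_zero_iff.1 hv).1
  refine ⟨b, a, ha, by rw [inv_div], by simp [quotMap], ?_⟩
  simp only [quotMap, quotDeriv, critPoly, eval_mul, eval_sub]
  field_simp
  ring

protected lemma sub_const (h : HasTaylor ψ x v e) (c : F) :
    HasTaylor (ψ - RatFunc.C c) x (v - c) e := by
  have := h.add (HasTaylor.const (-c) x)
  rwa [map_neg, ← sub_eq_add_neg, ← sub_eq_add_neg, add_zero] at this

protected lemma eval₂ (h : HasTaylor χ x v e) (p : F[X]) :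
    HasTaylor (p.eval₂ RatFunc.C χ) x (p.eval v) (p.derivative.eval v * e) := by
  induction p using Polynomial.induction_on' with
  | add p q hp hq =>
    have := hp.add hq
    rwa [← eval₂_add, ← eval_add, ← add_mul, ← eval_add, ← derivative_add] at this
  | monomial n c =>
    have hpow : ∀ n : ℕ, HasTaylor (χ ^ n) x (v ^ n) (n * v ^ (n - 1) * e) := by
      intro n
      induction n with
      | zero => simpa using HasTaylor.const (1 : F) x
      | succ n ih =>
        have := ih.mul h
        rw [← pow_succ, ← pow_succ] at this
        convert this using 1
        rcases n with _ | n
        · simp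
        · simp only [Nat.add_sub_cancel]
          push_cast
          ring
    have := (HasTaylor.const c x).mul (hpow n)
    rw [eval₂_monomial, eval_monomial, derivative_monomial, eval_monomial]
    convert this using 1
    ring

/-- The chain rule. -/
protected lemma comp (h : HasTaylor ψ v w e') (h' : HasTaylor χ x v e) :
    HasTaylor (comp ψ χ) x w (e' * e) := by
  obtain ⟨hd, hw, he⟩ := h.num_denom
  have := (h'.eval₂ ψ.num).mul ((h'.eval₂ ψ.denom).inv hd)
  rw [← div_eq_mul_inv] at this
  convert! this using 1
  · rw [← hw, div_eq_mul_inv]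
  · rw [← he, derivAt]
    field_simp
    ring

end HasTaylor

end Taylor

/-! ### Composition and conjugation of rational functions -/

section Comp

variable {F : Type*} [Field F]

/-- A rational function that is transcendental over the constants. -/
def Nonconst (ψ : RatFunc F) : Prop := ∀ p : F[X], p ≠ 0 → p.eval₂ RatFunc.C ψ ≠ 0

lemma nonconst_of_ne_C {ψ : RatFunc F} (h : ∀ c, ψ ≠ RatFunc.C c) : Nonconst ψ := by
  intro p hp h0
  refine RatFunc.transcendental_of_ne_C ψ (by push Not; exact h) ⟨p, hp, ?_⟩
  rwa [aeval_def, RatFunc.algebraMap_eq_C]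

lemma Nonconst.ne_C {ψ : RatFunc F} (h : Nonconst ψ) (c : F) : ψ ≠ RatFunc.C c := by
  rintro rfl
  exact h (X - C c) (X_sub_C_ne_zero c) (by simp)

/-- Substitution of a nonconstant rational function, as a ring homomorphism. -/
noncomputable def substHom (ψ : RatFunc F) (hψ : Nonconst ψ) : RatFunc F →+* RatFunc F :=
  RatFunc.liftRingHom (eval₂RingHom RatFunc.C ψ) fun p hp => by
    rw [Submonoid.mem_comap, mem_nonZeroDivisors_iff_ne_zero]
    exact hψ p (nonZeroDivisors.ne_zero hp)

/-- Identities for composition follow from substitution being a field homomorphism; nonconstancy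
keeps denominators from vanishing. -/
lemma comp_eq_substHom (φ : RatFunc F) {ψ : RatFunc F} (hψ : Nonconst ψ) :
    comp φ ψ = substHom ψ hψ φ := by
  rw [substHom, RatFunc.liftRingHom_apply]
  rfl

lemma comp_C (c : F) (ψ : RatFunc F) : comp (RatFunc.C c) ψ = RatFunc.C c := by
  simp [comp]

lemma X_comp (ψ : RatFunc F) : comp RatFunc.X ψ = ψ := by
  simp [comp]

lemma comp_X (φ : RatFunc F) : comp φ RatFunc.X = φ := by
  rw [comp, RatFunc.eval]
  have : ∀ p : F[X], p.eval₂ RatFunc.C RatFunc.X = algebraMap F[X] (RatFunc F) p := fun p => by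
    rw [← RatFunc.aeval_X_left_eq_algebraMap, aeval_def, RatFunc.algebraMap_eq_C]
  rw [this, this, RatFunc.num_div_denom]

section

variable {ψ : RatFunc F} (hψ : Nonconst ψ)

include hψ

lemma comp_add (φ χ : RatFunc F) : comp (φ + χ) ψ = comp φ ψ + comp χ ψ := by
  simp only [comp_eq_substHom _ hψ, map_add]

lemma comp_sub (φ χ : RatFunc F) : comp (φ - χ) ψ = comp φ ψ - comp χ ψ := by
  simp only [comp_eq_substHom _ hψ, map_sub]

lemma comp_div (φ χ : RatFunc F) : comp (φ / χ) ψ = comp φ ψ / comp χ ψ := by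
  simp only [comp_eq_substHom _ hψ, map_div₀]

lemma comp_inv (φ : RatFunc F) : comp φ⁻¹ ψ = (comp φ ψ)⁻¹ := by
  simp only [comp_eq_substHom _ hψ, map_inv₀]

lemma comp_injective {φ χ : RatFunc F} (h : comp φ ψ = comp χ ψ) : φ = χ := by
  simp only [comp_eq_substHom _ hψ] at h
  exact (substHom ψ hψ).injective h

lemma comp_eval₂ (p : F[X]) (χ : RatFunc F) :
    comp (p.eval₂ RatFunc.C χ) ψ = p.eval₂ RatFunc.C (comp χ ψ) := by
  rw [comp_eq_substHom _ hψ, comp_eq_substHom _ hψ, hom_eval₂]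
  congr 1
  ext c
  rw [RingHom.comp_apply, ← comp_eq_substHom, comp_C]

lemma comp_assoc (φ χ : RatFunc F) : comp (comp φ χ) ψ = comp φ (comp χ ψ) := by
  rw [comp.eq_1 φ χ, RatFunc.eval, comp_div hψ, comp_eval₂ hψ, comp_eval₂ hψ]
  rfl

lemma nonconst_comp {φ : RatFunc F} (hφ : Nonconst φ) : Nonconst (comp φ ψ) := by
  intro p hp h
  rw [← comp_eval₂ hψ, ← map_zero RatFunc.C, ← comp_C 0 ψ] at h
  have := comp_injective hψ h
  rw [map_zero] at this
  exact hφ p hp this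

lemma nonconst_inv : Nonconst ψ⁻¹ := by
  refine nonconst_of_ne_C fun c hc => hψ.ne_C c⁻¹ ?_
  rw [map_inv₀, ← hc, inv_inv]

lemma nonconst_C_add (c : F) : Nonconst (RatFunc.C c + ψ) := by
  refine nonconst_of_ne_C fun c' hc => hψ.ne_C (c' - c) ?_
  rw [map_sub, ← hc, add_sub_cancel_left]

end

lemma nonconst_X : Nonconst (RatFunc.X : RatFunc F) :=
  nonconst_of_ne_C fun c h => by
    have := congrArg RatFunc.num h
    rw [RatFunc.num_X, RatFunc.num_C] at this
    exact X_ne_C c this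

lemma nonconst_iter {φ : RatFunc F} (hφ : Nonconst φ) (n : ℕ) : Nonconst (iter φ n) := by
  induction n with
  | zero => exact nonconst_X
  | succ n ih => exact nonconst_comp ih hφ

lemma nonconst_of_degree_pos {φ : RatFunc F} (h : 0 < degree φ) : Nonconst φ := by
  refine nonconst_of_ne_C fun c hc => ?_
  rw [hc, degree, RatFunc.num_C, RatFunc.denom_C] at h
  simp at h

/-- The substitution `z ↦ q + 1 / z`. -/
noncomputable def shiftInv (q : F) : RatFunc F := RatFunc.C q + RatFunc.X⁻¹

lemma nonconst_shiftInv (q : F) : Nonconst (shiftInv q) :=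
  nonconst_C_add (nonconst_inv nonconst_X) q

/-- The conjugate of `φ` by the coordinate change `z ↦ 1 / (z - q)` moving `q` to `∞`. -/
noncomputable def conj (q : F) (φ : RatFunc F) : RatFunc F :=
  (comp φ (shiftInv q) - RatFunc.C q)⁻¹

lemma comp_shiftInv_eq (q : F) (φ : RatFunc F) :
    comp φ (shiftInv q) = RatFunc.C q + (conj q φ)⁻¹ := by
  rw [conj, inv_inv, add_sub_cancel]

lemma nonconst_conj (q : F) {φ : RatFunc F} (hφ : Nonconst φ) : Nonconst (conj q φ) := by
  have := nonconst_inv (nonconst_C_add (nonconst_comp (nonconst_shiftInv q) hφ) (-q))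
  rwa [map_neg, neg_add_eq_sub] at this

lemma conj_comp (q : F) (φ : RatFunc F) {ψ : RatFunc F} (hψ : Nonconst ψ) :
    conj q (comp φ ψ) = comp (conj q φ) (conj q ψ) := by
  have hm := nonconst_shiftInv q
  have hc := nonconst_conj q hψ
  have h1 : comp (shiftInv q) (conj q ψ) = comp ψ (shiftInv q) := by
    rw [comp_shiftInv_eq, shiftInv, comp_add hc, comp_inv hc, comp_C, X_comp]
  rw [conj, conj, comp_inv hc, comp_sub hc, comp_C, comp_assoc hm, comp_assoc hc, h1]

lemma conj_X (q : F) : conj q RatFunc.X = RatFunc.X := by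
  rw [conj, X_comp, shiftInv, add_sub_cancel_left, inv_inv]

lemma iter_conj (q : F) {φ : RatFunc F} (hφ : Nonconst φ) (n : ℕ) :
    iter (conj q φ) n = conj q (iter φ n) := by
  induction n with
  | zero => rw [iter, iter, conj_X]
  | succ n ih => rw [iter, iter, ih, conj_comp q φ (nonconst_iter hφ n)]

end Comp

/-! ### Charts at ∞ and invariance under change of coordinate -/

section Infinity

variable {F : Type*} [Field F]

lemma shiftInv_zero : shiftInv (0 : F) = RatFunc.X⁻¹ := by
  rw [shiftInv, map_zero, zero_add]

lemma eval₂_inv_X (p : F[X]) {d : ℕ} (hp : p.natDegree ≤ d) :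
    p.eval₂ RatFunc.C (RatFunc.X⁻¹ : RatFunc F) =
      algebraMap F[X] (RatFunc F) (reflect d p) / RatFunc.X ^ d := by
  let _ : Invertible (RatFunc.X⁻¹ : RatFunc F) :=
    invertibleOfNonzero (inv_ne_zero RatFunc.X_ne_zero)
  have := eval₂_reflect_mul_pow RatFunc.C (RatFunc.X⁻¹ : RatFunc F) d p hp
  rw [invOf_eq_inv, inv_inv, inv_pow, ← div_eq_mul_inv] at this
  rw [← this, ← RatFunc.aeval_X_left_eq_algebraMap, aeval_def, RatFunc.algebraMap_eq_C]

/-- Translate by q, then reverse coefficients relative to the common degree; the powers of X cancel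
in the quotient. -/
lemma comp_shiftInv_eq_div (q : F) (φ : RatFunc F) :
    comp φ (shiftInv q) =
      algebraMap F[X] (RatFunc F) (reflect (degree φ) (taylor q φ.num)) /
        algebraMap F[X] (RatFunc F) (reflect (degree φ) (taylor q φ.denom)) := by
  have key : ∀ p : F[X], p.natDegree ≤ degree φ → p.eval₂ RatFunc.C (shiftInv q) =
      algebraMap F[X] (RatFunc F) (reflect (degree φ) (taylor q p)) /
        RatFunc.X ^ degree φ := by
    intro p hp
    rw [← eval₂_inv_X _ (by rwa [natDegree_taylor]), taylor_apply, eval₂_comp]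
    congr 1
    simp [shiftInv, add_comm]
  rw [comp, RatFunc.eval, key _ (le_max_left _ _), key _ (le_max_right _ _),
    div_div_div_cancel_right₀ (pow_ne_zero _ RatFunc.X_ne_zero)]

lemma coeff_reflect_self (p : F[X]) (d : ℕ) : (reflect d p).coeff d = p.coeff 0 := by
  rw [coeff_reflect, revAt_le le_rfl, Nat.sub_self]

lemma eval_zero_reflect (p : F[X]) (d : ℕ) : (reflect d p).eval 0 = p.coeff d := by
  rw [← coeff_zero_eq_eval_zero, coeff_reflect, revAt_le (Nat.zero_le d), Nat.sub_zero]

lemma eval_zero_derivative_reflect (p : F[X]) {d : ℕ} (hd : 1 ≤ d) :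
    (derivative (reflect d p)).eval 0 = p.coeff (d - 1) := by
  rw [← coeff_zero_eq_eval_zero, coeff_derivative, coeff_reflect, revAt_le (by omega)]
  simp

lemma comp_inv_X_eq_div (φ : RatFunc F) :
    comp φ RatFunc.X⁻¹ =
      algebraMap F[X] (RatFunc F) (reflect (degree φ) φ.num) /
        algebraMap F[X] (RatFunc F) (reflect (degree φ) φ.denom) := by
  have := comp_shiftInv_eq_div 0 φ
  rwa [shiftInv_zero, taylor_zero, taylor_zero] at this

lemma natDegree_denom_eq_degree {φ : RatFunc F} (h : ¬ φ.denom.natDegree < φ.num.natDegree) :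
    φ.denom.natDegree = degree φ := (max_eq_right (not_lt.1 h)).symm

lemma natDegree_num_eq_degree {φ : RatFunc F} (h : φ.denom.natDegree < φ.num.natDegree) :
    φ.num.natDegree = degree φ := (max_eq_left h.le).symm

lemma hasTaylor_comp_inv_X {φ : RatFunc F} (h : ¬ φ.denom.natDegree < φ.num.natDegree) :
    ∃ e, HasTaylor (comp φ RatFunc.X⁻¹) 0
      (φ.num.coeff φ.denom.natDegree / φ.denom.leadingCoeff) e := by
  refine ⟨_, _, _, ?_, comp_inv_X_eq_div φ, ?_, rfl⟩
  · rw [eval_zero_reflect, ← natDegree_denom_eq_degree h]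
    exact leadingCoeff_ne_zero.2 φ.denom_ne_zero
  · rw [quotMap, eval_zero_reflect, eval_zero_reflect, ← natDegree_denom_eq_degree h]
    rfl

/-- The derivative is read off the reversed polynomials; it expresses the multiplier of a fixed ∞
through coefficients. -/
lemma hasTaylor_inv_comp_inv_X {φ : RatFunc F} (h : φ.denom.natDegree < φ.num.natDegree) :
    HasTaylor (comp φ RatFunc.X⁻¹)⁻¹ 0 0 (φ.denom.coeff (degree φ - 1) / φ.num.leadingCoeff) := by
  have hd : 1 ≤ degree φ := by rw [← natDegree_num_eq_degree h]; omega
  have h0 : φ.num ≠ 0 := by intro h0; simp [h0] at h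
  have hc : φ.num.coeff (degree φ) = φ.num.leadingCoeff := by
    rw [← natDegree_num_eq_degree h]; rfl
  have hc' : φ.denom.coeff (degree φ) = 0 :=
    coeff_eq_zero_of_natDegree_lt (by rwa [← natDegree_num_eq_degree h])
  have hl := leadingCoeff_ne_zero.2 h0
  refine ⟨_, _, ?_, by rw [comp_inv_X_eq_div, inv_div], ?_, ?_⟩
  · rwa [eval_zero_reflect, hc]
  · rw [quotMap, eval_zero_reflect, eval_zero_reflect, hc', zero_div]
  · simp only [quotDeriv, critPoly, eval_sub, eval_mul, eval_zero_derivative_reflect _ hd,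
      eval_zero_reflect, hc, hc']
    field_simp
    ring

/-- The coordinate `z ↦ 1 / (z - q)`, with junk value `0` at `q`. -/
noncomputable def shiftedInv (q : F) : OnePoint F → F
  | OnePoint.infty => 0
  | OnePoint.some x => (x - q)⁻¹

/-- The function equals t/(1 - qt), regular where t vanishes. Used with t = 1/φ when φ takes the
value ∞. -/
lemma hasTaylor_inv_sub_const {t : RatFunc F} {y e : F} (q : F) (ht : t ≠ 0)
    (h : HasTaylor t y 0 e) : ∃ e', HasTaylor (t⁻¹ - RatFunc.C q)⁻¹ y 0 e' := by
  have h1 := h.mul (((h.mul (HasTaylor.const (-q) y)).add (HasTaylor.const 1 y)).inv (by simp))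
  rw [zero_mul] at h1
  suffices h2 : (t⁻¹ - RatFunc.C q)⁻¹ = t * (t * RatFunc.C (-q) + RatFunc.C 1)⁻¹ from
    ⟨_, h2 ▸ h1⟩
  rw [← div_eq_mul_inv, ← inv_div, div_eq_mul_inv (_ + _) t, add_mul, mul_assoc,
    mul_comm (RatFunc.C (-q)) t⁻¹, ← mul_assoc, mul_inv_cancel₀ ht]
  simp
  ring

lemma toMap_coe (φ : RatFunc F) (x : F) [Decidable (φ.denom.eval x = 0)] :
    toMap φ (x : OnePoint F) = if φ.denom.eval x = 0 then OnePoint.infty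
      else ((φ.num.eval x / φ.denom.eval x : F) : OnePoint F) := by
  have : toMap φ (x : OnePoint F) = @ite _ (φ.denom.eval x = 0) (Classical.propDecidable _)
      OnePoint.infty ((φ.num.eval x / φ.denom.eval x : F) : OnePoint F) := rfl
  rw [this]
  congr

lemma toMap_infty (φ : RatFunc F) :
    toMap φ OnePoint.infty = if φ.denom.natDegree < φ.num.natDegree then OnePoint.infty
      else ((φ.num.coeff φ.denom.natDegree / φ.denom.leadingCoeff : F) : OnePoint F) :=
  rfl

lemma hasTaylor_shiftInv {q x : F} (hx : x ≠ q) :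
    HasTaylor (shiftInv q) (x - q)⁻¹ x (-(x - q) ^ 2) := by
  have hx' := sub_ne_zero.2 hx
  have := (HasTaylor.const q (x - q)⁻¹).add ((HasTaylor.X (x - q)⁻¹).inv (inv_ne_zero hx'))
  convert! this using 1
  · rw [inv_inv]; ring
  · field_simp
    ring

/-- The function z/(1 + qz) is the transition at ∞ from the coordinate 1/(z - q) to 1/z. Its
derivative 1 means that both charts see the same multiplier. -/
lemma hasTaylor_X_div (q : F) :
    HasTaylor (RatFunc.X / (1 + RatFunc.C q * RatFunc.X)) 0 0 1 := by
  have := (HasTaylor.X (0 : F)).mul (((HasTaylor.const 1 (0 : F)).add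
    ((HasTaylor.const q 0).mul (HasTaylor.X 0))).inv (by simp))
  rw [div_eq_mul_inv]
  convert this using 1 <;> simp

lemma inv_X_div (q : F) :
    (RatFunc.X / (1 + RatFunc.C q * RatFunc.X))⁻¹ = shiftInv q := by
  rw [inv_div, shiftInv, add_div, mul_div_assoc, div_self RatFunc.X_ne_zero]
  ring

lemma nonconst_X_div (q : F) : Nonconst (RatFunc.X / (1 + RatFunc.C q * RatFunc.X)) := by
  have := nonconst_inv (nonconst_shiftInv q)
  rwa [← inv_X_div, inv_inv] at this

/-- The conjugate `conj q φ` acts like `φ` in the coordinate `z ↦ 1 / (z - q)`. -/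
lemma exists_hasTaylor_conj {q : F} {φ : RatFunc F} (hφ : Nonconst φ) {P : OnePoint F}
    (hP : P ≠ (q : OnePoint F)) (hP' : toMap φ P ≠ (q : OnePoint F)) :
    ∃ e, HasTaylor (conj q φ) (shiftedInv q P) (shiftedInv q (toMap φ P)) e := by
  classical
  have hne : comp φ (shiftInv q) ≠ 0 := by
    rw [← map_zero RatFunc.C]
    exact (nonconst_comp (nonconst_shiftInv q) hφ).ne_C 0
  have finite : ∀ {y v : F}, (∃ e, HasTaylor (comp φ (shiftInv q)) y v e) →
      toMap φ P = (v : OnePoint F) →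
      ∃ e, HasTaylor (conj q φ) y (shiftedInv q (toMap φ P)) e := by
    rintro y v ⟨e, h⟩ hv
    have hvq : v - q ≠ 0 := by
      rw [sub_ne_zero]; rintro rfl; exact hP' hv
    rw [hv]
    exact ⟨_, (h.sub_const q).inv hvq⟩
  have infinite : ∀ {y : F}, (∃ e, HasTaylor (comp φ (shiftInv q))⁻¹ y 0 e) →
      toMap φ P = OnePoint.infty →
      ∃ e, HasTaylor (conj q φ) y (shiftedInv q (toMap φ P)) e := by
    rintro y ⟨e, h⟩ hv
    rw [hv]
    have := hasTaylor_inv_sub_const q (inv_ne_zero hne) h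
    rwa [inv_inv] at this
  induction P using OnePoint.rec with
  | infty =>
    have hcomp : comp φ (shiftInv q) =
        comp (comp φ RatFunc.X⁻¹) (RatFunc.X / (1 + RatFunc.C q * RatFunc.X)) := by
      rw [comp_assoc (nonconst_X_div q), comp_inv (nonconst_X_div q), X_comp, inv_X_div]
    by_cases h : φ.denom.natDegree < φ.num.natDegree
    · refine infinite ?_ (by rw [toMap_infty, if_pos h])
      rw [hcomp, ← comp_inv (nonconst_X_div q)]
      exact ⟨_, (hasTaylor_inv_comp_inv_X h).comp (hasTaylor_X_div q)⟩
    · obtain ⟨e, he⟩ := hasTaylor_comp_inv_X h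
      refine finite ?_ (by rw [toMap_infty, if_neg h])
      rw [hcomp]
      exact ⟨_, he.comp (hasTaylor_X_div q)⟩
  | coe x =>
    have hxq : x ≠ q := fun h => hP (h ▸ rfl)
    by_cases h : φ.denom.eval x = 0
    · refine infinite ?_ (by rw [toMap_coe, if_pos h])
      have hn : φ.num.eval x ≠ 0 := by
        obtain ⟨a, b, hab⟩ := RatFunc.isCoprime_num_denom φ
        intro hn
        have := congrArg (eval x) hab
        simp [h, hn] at this
      have : HasTaylor φ⁻¹ x 0 _ :=
        ⟨φ.denom, φ.num, hn, by rw [← inv_div, RatFunc.num_div_denom], by simp [quotMap, h], rfl⟩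
      rw [← comp_inv (nonconst_shiftInv q)]
      exact ⟨_, this.comp (hasTaylor_shiftInv hxq)⟩
    · refine finite ?_ (by rw [toMap_coe, if_neg h])
      exact ⟨_, (hasTaylor_of_denom_ne_zero h).comp (hasTaylor_shiftInv hxq)⟩

/-- The multiplier of a fixed point is invariant under the coordinate change `z ↦ 1 / (z - q)`. -/
lemma fixedMultiplier_eq_of_conj {q : F} {ψ : RatFunc F} (hψ : Nonconst ψ) {P : OnePoint F}
    (hP : P ≠ (q : OnePoint F)) {e : F}
    (h : HasTaylor (conj q ψ) (shiftedInv q P) (shiftedInv q P) e) :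
    fixedMultiplier ψ P = e := by
  induction P using OnePoint.rec with
  | infty =>
    change HasTaylor (conj q ψ) 0 0 e at h
    have hX : (1 + RatFunc.C (-q) * RatFunc.X : RatFunc F) = 1 - RatFunc.C q * RatFunc.X := by
      rw [map_neg]; ring
    have hu : conj q ψ ≠ 0 := by
      rw [← map_zero RatFunc.C]
      exact (nonconst_conj q hψ).ne_C 0
    have hw := nonconst_X_div (-q)
    have hcomp : comp ψ RatFunc.X⁻¹ =
        comp (comp ψ (shiftInv q)) (RatFunc.X / (1 + RatFunc.C (-q) * RatFunc.X)) := by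
      rw [comp_assoc hw]
      congr 1
      rw [shiftInv, comp_add hw, comp_inv hw, comp_C, X_comp, inv_X_div, shiftInv, map_neg]
      ring
    have h1 : HasTaylor (comp ψ (shiftInv q))⁻¹ 0 0 e := by
      have h2 := h.mul (((h.mul (HasTaylor.const q 0)).add (HasTaylor.const 1 0)).inv (by simp))
      convert! h2 using 1
      · rw [comp_shiftInv_eq, ← div_eq_mul_inv, ← inv_div]
        congr 1
        field_simp
        simp
      · simp
      · simp
    have h3 := h1.comp (hasTaylor_X_div (-q))
    rw [comp_inv hw, ← hcomp, mul_one] at h3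
    exact h3.derivAt_eq
  | coe x =>
    have hxq : x ≠ q := fun h => hP (h ▸ rfl)
    have hx' := sub_ne_zero.2 hxq
    change HasTaylor (conj q ψ) (x - q)⁻¹ (x - q)⁻¹ e at h
    have h1 := (HasTaylor.const q (x - q)⁻¹).add (h.inv (inv_ne_zero hx'))
    rw [← comp_shiftInv_eq, inv_inv, add_sub_cancel] at h1
    have h2 := ((HasTaylor.X x).sub_const q).inv hx'
    have hnc : Nonconst (RatFunc.X - RatFunc.C q : RatFunc F)⁻¹ := by
      have := nonconst_inv (nonconst_C_add nonconst_X (-q))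
      rwa [map_neg, neg_add_eq_sub] at this
    have h3 := h1.comp h2
    rw [comp_assoc hnc, shiftInv, comp_add hnc, comp_inv hnc, comp_C, X_comp, inv_inv,
      add_sub_cancel, comp_X] at h3
    have h4 : fixedMultiplier ψ (x : OnePoint F) = derivAt ψ x := rfl
    rw [h4, h3.derivAt_eq]
    field_simp
    ring

/-- The value and derivative of an iterate along an orbit of regular points. -/
lemma hasTaylor_iter {Φ : RatFunc F} {y : ℕ → F} {e : ℕ → F}
    (h : ∀ i, HasTaylor Φ (y i) (y (i + 1)) (e i)) (n : ℕ) :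
    HasTaylor (iter Φ n) (y 0) (y n) (∏ i ∈ Finset.range n, e i) := by
  induction n with
  | zero => simpa [iter] using HasTaylor.X (y 0)
  | succ n ih =>
    rw [Finset.prod_range_succ, mul_comm]
    exact (h n).comp ih

end Infinity

/-! ### The bound over an algebraically closed field -/

section Bound

variable {L : Type*} [NormedField L]

/-- A family of periodic points on pairwise distinct attracting cycles. -/
structure IsAttractingFamily {ι : Type*} (φ : RatFunc L) (γ : ι → OnePoint L) : Prop where
  mem_periodicPts : ∀ a, γ a ∈ Function.periodicPts (toMap φ)
  norm_multiplier_lt : ∀ a, ‖multiplier φ (γ a)‖ < 1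
  eq_of_iterate_eq : ∀ a b k, (toMap φ)^[k] (γ a) = γ b → a = b

lemma iter_one (φ : RatFunc L) : iter φ 1 = φ := comp_X φ

/-- An attracting cycle does not pass through a fixed point that is not attracting. -/
lemma IsAttractingFamily.iterate_ne {ι : Type*} {φ : RatFunc L} {γ : ι → OnePoint L}
    (h : IsAttractingFamily φ γ) {Q : OnePoint L} (hQ : toMap φ Q = Q)
    (hm : 1 ≤ ‖fixedMultiplier φ Q‖) (a : ι) (i : ℕ) : (toMap φ)^[i] (γ a) ≠ Q := by
  intro hi
  have hfix : Function.IsFixedPt (toMap φ) Q := hQ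
  have hγ : γ a = Q := by
    obtain ⟨n, hn, hper⟩ := h.mem_periodicPts a
    have h1 : (toMap φ)^[n * i] (γ a) = Q := by
      obtain ⟨k, hk⟩ := Nat.exists_eq_add_of_le (Nat.le_mul_of_pos_left i hn)
      rw [hk, add_comm, Function.iterate_add_apply, hi]
      exact hfix.iterate k
    rw [← h1]
    exact (hper.mul_const i).eq.symm
  have h1 := h.norm_multiplier_lt a
  rw [multiplier, hγ, Function.minimalPeriod_eq_one_iff_isFixedPt.2 hfix, iter_one] at h1
  linarith

variable [IsUltrametricDist L] [IsAlgClosed L]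

/-- The bound for the number of attracting cycles, given an affine coordinate `M` away from a fixed
point `Q` in which the map becomes a tame rational function `a / b`. -/
lemma IsAttractingFamily.card_le_of_coordinate {ι : Type*} {φ : RatFunc L} {γ : ι → OnePoint L}
    (h : IsAttractingFamily φ γ) {Q : OnePoint L} (hQ : toMap φ Q = Q)
    (hm : 1 ≤ ‖fixedMultiplier φ Q‖) {a b : L[X]} (ht : IsTame a b) (hb : b ≠ 0)
    (M : OnePoint L → L) (hM : ∀ P P', P ≠ Q → P' ≠ Q → M P = M P' → P = P')
    (hval : ∀ P, P ≠ Q → toMap φ P ≠ Q →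
      ∃ e, HasTaylor (algebraMap L[X] (RatFunc L) a / algebraMap L[X] (RatFunc L) b)
        (M P) (M (toMap φ P)) e)
    (hmult : ∀ n P e, P ≠ Q →
      HasTaylor (iter (algebraMap L[X] (RatFunc L) a / algebraMap L[X] (RatFunc L) b) n)
        (M P) (M P) e → fixedMultiplier (iter φ n) P = e) :
    ENat.card ι ≤ ((2 * a.natDegree - 2 : ℕ) : ℕ∞) := by
  have hne := h.iterate_ne hQ hm
  have hstep : ∀ c i, ∃ e, HasTaylor
      (algebraMap L[X] (RatFunc L) a / algebraMap L[X] (RatFunc L) b)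
      (M ((toMap φ)^[i] (γ c))) (M ((toMap φ)^[i + 1] (γ c))) e := by
    intro c i
    rw [Function.iterate_succ_apply']
    refine hval _ (hne c i) ?_
    rw [← Function.iterate_succ_apply' (toMap φ)]
    exact hne c (i + 1)
  choose e he using hstep
  have hev := fun c i => (he c i).of_isCoprime ht.isCoprime hb
  have hiter : ∀ c i, (quotMap a b)^[i] (M (γ c)) = M ((toMap φ)^[i] (γ c)) := by
    intro c i
    induction i with
    | zero => rfl
    | succ i ih => rw [Function.iterate_succ_apply', ih, (hev c i).2.1]
  have hmin : ∀ c, (toMap φ)^[Function.minimalPeriod (toMap φ) (γ c)] (γ c) = γ c :=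
    fun c => Function.isPeriodicPt_minimalPeriod _ _
  refine ht.card_attracting_le (fun c => M (γ c))
    (fun c => Function.minimalPeriod (toMap φ) (γ c)) ?_ ?_ ?_ ?_ ?_
  · exact fun c => Function.minimalPeriod_pos_of_mem_periodicPts (h.mem_periodicPts c)
  · intro c
    rw [Function.IsPeriodicPt, Function.IsFixedPt, hiter, hmin]
  · intro c i
    rw [hiter]
    exact (hev c i).1
  · intro c
    have h1 := hasTaylor_iter (he c) (Function.minimalPeriod (toMap φ) (γ c))
    rw [hmin, Function.iterate_zero_apply] at h1
    have h2 := hmult _ _ _ (hne c 0) h1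
    have h3 := h.norm_multiplier_lt c
    rw [multiplier, ← Function.iterate_zero_apply (toMap φ) (γ c)] at h3
    rw [Function.iterate_zero_apply] at h2
    rw [Function.iterate_zero_apply, h2] at h3
    convert h3 using 3 with i
    rw [hiter, (hev c i).2.2]
  · intro c c' k hk
    rw [hiter] at hk
    exact h.eq_of_iterate_eq c c' k (hM _ _ (hne c k) (hne c' 0) hk)

/-- The affine coordinate, with junk value `0` at `∞`. -/
noncomputable def affineCoord {F : Type*} [Field F] : OnePoint F → F
  | OnePoint.infty => 0
  | OnePoint.some x => x

/-- The bound when `∞` is a fixed point that is not attracting. -/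
lemma IsAttractingFamily.card_le_of_infty {ι : Type*} {φ : RatFunc L} {γ : ι → OnePoint L}
    (h : IsAttractingFamily φ γ) (hφ2 : 2 ≤ degree φ)
    (hd : ∀ m : ℕ, 1 ≤ m → m ≤ degree φ → ‖(m : L)‖ = 1)
    (hdeg : φ.denom.natDegree < φ.num.natDegree)
    (hm : 1 ≤ ‖fixedMultiplier φ OnePoint.infty‖) :
    ENat.card ι ≤ ((2 * degree φ - 2 : ℕ) : ℕ∞) := by
  classical
  have hnd := natDegree_num_eq_degree hdeg
  have ht : IsTame φ.num φ.denom :=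
    ⟨hdeg, by rwa [hnd], by rwa [hnd], RatFunc.isCoprime_num_denom φ⟩
  rw [← hnd]
  refine h.card_le_of_coordinate (Q := OnePoint.infty) (by rw [toMap_infty, if_pos hdeg]) hm ht
    φ.denom_ne_zero affineCoord ?_ ?_ ?_
  · intro P P' hP hP' heq
    induction P using OnePoint.rec with
    | infty => exact absurd rfl hP
    | coe x =>
      induction P' using OnePoint.rec with
      | infty => exact absurd rfl hP'
      | coe x' => exact congrArg _ heq
  · intro P hP hP'
    rw [RatFunc.num_div_denom]
    induction P using OnePoint.rec with
    | infty => exact absurd rfl hP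
    | coe x =>
      have hx : φ.denom.eval x ≠ 0 := by
        intro hx
        rw [toMap_coe, if_pos hx] at hP'
        exact hP' rfl
      rw [toMap_coe, if_neg hx]
      exact ⟨_, hasTaylor_of_denom_ne_zero hx⟩
  · intro n P e hP he
    rw [RatFunc.num_div_denom] at he
    induction P using OnePoint.rec with
    | infty => exact absurd rfl hP
    | coe x => exact he.derivAt_eq

omit [IsUltrametricDist L] in
lemma isCoprime_of_eval_ne_zero {f g : L[X]} (h : ∀ z, f.eval z = 0 → g.eval z ≠ 0) :
    IsCoprime f g := by
  rw [isCoprime_iff_aeval_ne_zero_of_isAlgClosed L L]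
  intro z
  change f.eval z ≠ 0 ∨ g.eval z ≠ 0
  exact or_iff_not_imp_left.2 fun hf => h z (not_not.1 hf)

/-- The bound when `q` is a finite fixed point that is not attracting. -/
lemma IsAttractingFamily.card_le_of_coe {ι : Type*} {φ : RatFunc L} {γ : ι → OnePoint L}
    (h : IsAttractingFamily φ γ) (hφ2 : 2 ≤ degree φ)
    (hd : ∀ m : ℕ, 1 ≤ m → m ≤ degree φ → ‖(m : L)‖ = 1) {q : L} (hq : φ.denom.eval q ≠ 0)
    (hfix : φ.num.eval q = q * φ.denom.eval q) (hm : 1 ≤ ‖derivAt φ q‖) :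
    ENat.card ι ≤ ((2 * degree φ - 2 : ℕ) : ℕ∞) := by
  classical
  have hφ : Nonconst φ := nonconst_of_degree_pos (by omega)
  set d := degree φ with hd_def
  set N := reflect d (taylor q φ.num)
  set D := reflect d (taylor q φ.denom)
  have hdegN : (taylor q φ.num).natDegree ≤ d := by rw [natDegree_taylor]; exact le_max_left _ _
  have hdegD : (taylor q φ.denom).natDegree ≤ d := by
    rw [natDegree_taylor]; exact le_max_right _ _
  have hrefl : ∀ p : L[X], p.natDegree ≤ d → (reflect d p).natDegree ≤ d := by
    intro p hp
    exact (natDegree_reflect_le (p := p) (N := d)).trans (max_le le_rfl hp)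
  have hD : D.natDegree = d := by
    refine le_antisymm (hrefl _ hdegD) (le_natDegree_of_ne_zero ?_)
    rwa [coeff_reflect_self, taylor_coeff_zero]
  have hD0 : D ≠ 0 := by intro h0; rw [h0, natDegree_zero] at hD; omega
  -- The coefficient of degree d is f(q) - q g(q), which vanishes because q is fixed: the new map
  -- fixes ∞.
  have hE : (N - C q * D).natDegree < d := by
    refine lt_of_le_of_ne ((natDegree_sub_le _ _).trans (max_le (hrefl _ hdegN)
      ((natDegree_C_mul_le q D).trans hD.le))) fun h0 => ?_
    have h1 : (N - C q * D).coeff d = 0 := by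
      rw [coeff_sub, coeff_C_mul, coeff_reflect_self, coeff_reflect_self, taylor_coeff_zero,
        taylor_coeff_zero, hfix, sub_self]
    have h2 : N - C q * D = 0 := by
      rw [← leadingCoeff_eq_zero, leadingCoeff, h0, h1]
    rw [h2, natDegree_zero] at h0
    omega
  -- A common root z ≠ 0 would give a common zero q + 1/z of numerator and denominator of φ; z = 0
  -- would make both their coefficients of degree d vanish.
  have hroot : ∀ z, D.eval z = 0 → (N - C q * D).eval z ≠ 0 := by
    intro z hz hz'
    rw [eval_sub, eval_mul, hz, mul_zero, sub_zero] at hz'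
    obtain ⟨u, v, huv⟩ := RatFunc.isCoprime_num_denom φ
    by_cases hz0 : z = 0
    · subst hz0
      rw [eval_zero_reflect] at hz hz'
      rcases le_total φ.num.natDegree φ.denom.natDegree with hle | hle
      · have hdd : d = φ.denom.natDegree := max_eq_right hle
        rw [hdd, coeff_taylor_natDegree] at hz
        exact φ.denom_ne_zero (leadingCoeff_eq_zero.1 hz)
      · have hdd : d = φ.num.natDegree := max_eq_left hle
        rw [hdd, coeff_taylor_natDegree, leadingCoeff_eq_zero] at hz'
        rw [hz', natDegree_zero] at hdd
        omega
    · let _ : Invertible z⁻¹ := invertibleOfNonzero (inv_ne_zero hz0)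
      have key : ∀ p : L[X], p.natDegree ≤ d → (reflect d p).eval z = 0 → p.eval z⁻¹ = 0 := by
        intro p hp h0
        have := eval₂_reflect_mul_pow (RingHom.id L) z⁻¹ d p hp
        rw [invOf_eq_inv, inv_inv, ← eval, h0, zero_mul] at this
        exact this.symm
      have h1 := key _ hdegN hz'
      have h2 := key _ hdegD hz
      rw [taylor_eval] at h1 h2
      have := congrArg (eval (z⁻¹ + q)) huv
      simp [h1, h2] at this
  have hE0 : N - C q * D ≠ 0 := by
    intro h0
    obtain ⟨z, hz⟩ := IsAlgClosed.exists_root D (by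
      rw [degree_eq_natDegree hD0, hD]
      exact_mod_cast (by omega : d ≠ 0))
    exact hroot z hz (by rw [h0, eval_zero])
  have ht : IsTame D (N - C q * D) :=
    ⟨by rwa [hD], by rwa [hD], by rwa [hD], isCoprime_of_eval_ne_zero hroot⟩
  have hconj : conj q φ = algebraMap L[X] (RatFunc L) D /
      algebraMap L[X] (RatFunc L) (N - C q * D) := by
    have h1 := RatFunc.algebraMap_ne_zero hD0
    rw [conj, comp_shiftInv_eq_div, map_sub, map_mul, RatFunc.algebraMap_C,
      ← inv_div (_ - _) (algebraMap L[X] (RatFunc L) D), sub_div, mul_div_assoc, div_self h1,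
      mul_one]
  rw [← hD]
  refine h.card_le_of_coordinate (Q := (q : OnePoint L)) ?_ hm ht hE0 (shiftedInv q) ?_ ?_ ?_
  · rw [toMap_coe, if_neg hq, hfix, mul_div_cancel_right₀ _ hq]
  · intro P P' hP hP' heq
    have hsub : ∀ x : L, (x : OnePoint L) ≠ q → x - q ≠ 0 := fun x hx =>
      sub_ne_zero.2 fun hxq => hx (hxq ▸ rfl)
    induction P using OnePoint.rec with
    | infty =>
      induction P' using OnePoint.rec with
      | infty => rfl
      | coe x' => exact absurd heq.symm (inv_ne_zero (hsub x' hP'))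
    | coe x =>
      induction P' using OnePoint.rec with
      | infty => exact absurd heq (inv_ne_zero (hsub x hP))
      | coe x' => exact congrArg _ (sub_left_injective (inv_injective heq))
  · intro P hP hP'
    rw [← hconj]
    exact exists_hasTaylor_conj hφ hP hP'
  · intro n P e hP he
    rw [← hconj, iter_conj q hφ] at he
    exact fixedMultiplier_eq_of_conj (nonconst_iter hφ n) hP he

omit [IsUltrametricDist L] in
/-- Lagrange's formula for the sum of `g / P'` over the roots of a separable polynomial `P`. -/
lemma sum_eval_div_eval_derivative {P g : L[X]} (hP : P ≠ 0) (hg : g.natDegree < P.natDegree)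
    (hsep : ∀ z ∈ P.roots, (derivative P).eval z ≠ 0) :
    (P.roots.map fun z => g.eval z / (derivative P).eval z).sum =
      g.coeff (P.natDegree - 1) / P.leadingCoeff := by
  classical
  have hnd : P.roots.Nodup := by
    rw [Multiset.nodup_iff_count_le_one]
    intro z
    rw [count_roots]
    by_contra! hlt
    have := ((one_lt_rootMultiplicity_iff_isRoot hP).1 hlt)
    exact hsep z ((mem_roots hP).2 this.1) this.2
  have hlc := leadingCoeff_ne_zero.2 hP
  have hcard : P.roots.toFinset.card = P.natDegree := by
    rw [Multiset.toFinset_card_of_nodup hnd, ← (IsAlgClosed.splits P).natDegree_eq_card_roots]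
  have hgd : g.degree < (P.roots.toFinset.card : ℕ) := by
    rw [hcard]; exact lt_of_le_of_lt degree_le_natDegree (by exact_mod_cast hg)
  have hinj : Set.InjOn (fun z : L => z) (P.roots.toFinset : Set L) := fun _ _ _ _ h => h
  have h1 := Lagrange.coeff_eq_sum hinj hgd
  rw [hcard] at h1
  rw [h1, Finset.sum_div, Finset.sum, Multiset.toFinset_val, hnd.dedup]
  congr 1
  refine Multiset.map_congr rfl fun z hz => ?_
  have h2 : (derivative P).eval z =
      P.leadingCoeff * ∏ j ∈ P.roots.toFinset.erase z, (z - j) := by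
    have h3 : P = (X - C z) *
        (C P.leadingCoeff * ∏ j ∈ P.roots.toFinset.erase z, (X - C j)) := by
      rw [mul_left_comm, Finset.mul_prod_erase _ (fun j => X - C j) (Multiset.mem_toFinset.2 hz),
        Finset.prod, Multiset.toFinset_val, hnd.dedup]
      exact (IsAlgClosed.splits P).eq_prod_roots
    conv_lhs => rw [h3]
    simp [eval_prod]
  rw [h2, div_div, mul_comm P.leadingCoeff]

omit [IsAlgClosed L] in
lemma norm_sum_sub_card_lt {R : Multiset L} {u : L → L} (h : ∀ z ∈ R, ‖u z - 1‖ < 1) :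
    ‖(R.map u).sum - (R.card : L)‖ < 1 := by
  induction R using Multiset.induction_on with
  | empty => simp
  | cons z R ih =>
    rw [Multiset.map_cons, Multiset.sum_cons, Multiset.card_cons, Nat.cast_succ,
      show u z + (R.map u).sum - ((R.card : L) + 1) = (u z - 1) + ((R.map u).sum - R.card) by ring]
    exact (IsUltrametricDist.norm_add_le_max _ _).trans_lt
      (max_lt (h z (Multiset.mem_cons_self _ _)) (ih fun w hw => h w (Multiset.mem_cons_of_mem hw)))

omit [IsAlgClosed L] in
lemma norm_one_sub_eq_one {l : L} (hl : ‖l‖ < 1) : ‖1 - l‖ = 1 := by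
  rw [sub_eq_add_neg, IsUltrametricDist.norm_add_eq_max_of_norm_ne_norm, norm_neg, norm_one,
    max_eq_left hl.le]
  rw [norm_neg, norm_one]
  exact hl.ne'

/-- A tame rational function has a fixed point that is not attracting. -/
lemma exists_nonattracting_fixedPoint {φ : RatFunc L} (hφ1 : 1 ≤ degree φ)
    (hd : ‖(degree φ : L)‖ = 1)
    (hinf : φ.denom.natDegree < φ.num.natDegree → ‖fixedMultiplier φ OnePoint.infty‖ < 1) :
    ∃ q, φ.denom.eval q ≠ 0 ∧ φ.num.eval q = q * φ.denom.eval q ∧ 1 ≤ ‖derivAt φ q‖ := by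
  by_contra! hB
  -- The roots of P are the finite fixed points, and g(z)/P'(z) = 1/(1 - λ) there. If all are
  -- attracting, P is separable and each term is congruent to 1, so the sum is congruent to deg P.
  set P := X * φ.denom - φ.num
  have hg0 := φ.denom_ne_zero
  have hroot : ∀ z ∈ P.roots, (derivative P).eval z ≠ 0 ∧
      ‖φ.denom.eval z / (derivative P).eval z - 1‖ < 1 := by
    intro z hz
    have hz' : z * φ.denom.eval z - φ.num.eval z = 0 := by
      have : P.eval z = 0 := isRoot_of_mem_roots hz
      simpa [P] using this
    have hfz : φ.num.eval z = z * φ.denom.eval z := (sub_eq_zero.1 hz').symm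
    have hgz : φ.denom.eval z ≠ 0 := by
      intro h0
      obtain ⟨u, v, huv⟩ := RatFunc.isCoprime_num_denom φ
      have := congrArg (eval z) huv
      simp [hfz, h0] at this
    have hl := hB z hgz hfz
    have hl1 : 1 - derivAt φ z ≠ 0 := by
      rw [← norm_pos_iff, norm_one_sub_eq_one hl]; exact one_pos
    have hP' : (derivative P).eval z = φ.denom.eval z * (1 - derivAt φ z) := by
      simp only [P, derivAt, hfz, derivative_sub, derivative_mul, derivative_X, eval_sub, eval_add,
        eval_mul, eval_X, one_mul]
      field_simp
      ring
    rw [hP']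
    refine ⟨mul_ne_zero hgz hl1, ?_⟩
    rw [show φ.denom.eval z / (φ.denom.eval z * (1 - derivAt φ z)) - 1 =
      derivAt φ z / (1 - derivAt φ z) by field_simp; ring, norm_div, norm_one_sub_eq_one hl, div_one]
    exact hl
  -- By Lagrange the sum is a quotient of coefficients. If ∞ is not fixed, it is 1 and deg P = d +
  -- 1. If ∞ is fixed with multiplier l, it is -l/(1 - l) and deg P = d. Either way it differs from
  -- deg P by a unit, since |d| = 1.
  suffices P ≠ 0 ∧ φ.denom.natDegree < P.natDegree ∧
      ‖φ.denom.coeff (P.natDegree - 1) / P.leadingCoeff - (P.natDegree : L)‖ = 1 by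
    obtain ⟨hP, hlt, h1⟩ := this
    have h2 := norm_sum_sub_card_lt fun z hz => (hroot z hz).2
    rw [sum_eval_div_eval_derivative hP hlt fun z hz => (hroot z hz).1,
      ← (IsAlgClosed.splits P).natDegree_eq_card_roots] at h2
    exact h2.ne h1
  by_cases hdeg : φ.denom.natDegree < φ.num.natDegree
  · have hnd := natDegree_num_eq_degree hdeg
    have hl := hinf hdeg
    have hl' : fixedMultiplier φ OnePoint.infty =
        φ.denom.coeff (degree φ - 1) / φ.num.leadingCoeff :=
      (hasTaylor_inv_comp_inv_X hdeg).derivAt_eq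
    set l := fixedMultiplier φ OnePoint.infty
    have hf0 : φ.num ≠ 0 := by intro h0; simp [h0] at hdeg
    have hlc := leadingCoeff_ne_zero.2 hf0
    have hl1 : 1 - l ≠ 0 := by
      rw [← norm_pos_iff, norm_one_sub_eq_one hl]; exact one_pos
    rw [eq_div_iff hlc] at hl'
    have hcoeff : P.coeff (degree φ) = -(φ.num.leadingCoeff * (1 - l)) := by
      obtain ⟨k, hk⟩ := Nat.exists_eq_add_of_le' hφ1
      rw [hk, Nat.add_sub_cancel] at hl'
      rw [coeff_sub, hk, coeff_X_mul, ← hk, ← hnd, ← hl', coeff_natDegree]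
      ring
    have hne : P.coeff (degree φ) ≠ 0 := by
      rw [hcoeff]; exact neg_ne_zero.2 (mul_ne_zero hlc hl1)
    have hPd : P.natDegree = degree φ := by
      refine le_antisymm ((natDegree_sub_le _ _).trans (max_le ?_ hnd.le))
        (le_natDegree_of_ne_zero hne)
      rw [natDegree_X_mul hg0]
      omega
    refine ⟨fun h0 => hne (by rw [h0, coeff_zero]), by omega, ?_⟩
    rw [leadingCoeff, hPd, hcoeff, ← hl']
    rw [show l * φ.num.leadingCoeff / -(φ.num.leadingCoeff * (1 - l)) - (degree φ : L) =
      -(l / (1 - l)) + -(degree φ : L) by field_simp; ring]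
    have hlt : ‖-(l / (1 - l))‖ < 1 := by
      rw [norm_neg, norm_div, norm_one_sub_eq_one hl, div_one]; exact hl
    rw [IsUltrametricDist.norm_add_eq_max_of_norm_ne_norm, norm_neg (degree φ : L), hd,
      max_eq_right hlt.le]
    rw [norm_neg (degree φ : L), hd]
    exact hlt.ne
  · have hgd := natDegree_denom_eq_degree hdeg
    have hlt : φ.num.natDegree < (X * φ.denom).natDegree := by
      rw [natDegree_X_mul hg0]
      omega
    have hPd : P.natDegree = degree φ + 1 := by
      rw [natDegree_sub_eq_left_of_natDegree_lt hlt, natDegree_X_mul hg0, hgd]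
    have hPc : P.leadingCoeff = φ.denom.leadingCoeff := by
      rw [leadingCoeff_sub_of_degree_lt (degree_lt_degree hlt), leadingCoeff_mul, leadingCoeff_X,
        one_mul]
    refine ⟨fun h0 => by rw [h0, natDegree_zero] at hPd; omega, by omega, ?_⟩
    rw [hPc, hPd, Nat.add_sub_cancel, ← hgd, coeff_natDegree,
      div_self (leadingCoeff_ne_zero.2 hg0), hgd, Nat.cast_add_one, sub_add_cancel_right, norm_neg,
      hd]

/-- Over an algebraically closed field, a rational function of degree `d` less than the residue
characteristic has at most `2 d - 2` attracting cycles. -/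
theorem IsAttractingFamily.card_le {ι : Type*} {φ : RatFunc L} {γ : ι → OnePoint L}
    (h : IsAttractingFamily φ γ) (hφ2 : 2 ≤ degree φ)
    (hd : ∀ m : ℕ, 1 ≤ m → m ≤ degree φ → ‖(m : L)‖ = 1) :
    ENat.card ι ≤ ((2 * degree φ - 2 : ℕ) : ℕ∞) := by
  by_cases hinf : φ.denom.natDegree < φ.num.natDegree → ‖fixedMultiplier φ OnePoint.infty‖ < 1
  · obtain ⟨q, hq, hfix, hm⟩ := exists_nonattracting_fixedPoint (by omega)
      (hd _ (by omega) le_rfl) hinf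
    exact h.card_le_of_coe hφ2 hd hq hfix hm
  · push Not at hinf
    exact h.card_le_of_infty hφ2 hd hinf.1 hinf.2

end Bound

/-! ### Extension of the ground field -/

section BaseChange

variable {K L : Type*} [Field K] [Field L] (σ : K →+* L)

/-- Extension of scalars of rational functions. -/
noncomputable def baseChange : RatFunc K →+* RatFunc L :=
  RatFunc.liftRingHom ((algebraMap L[X] (RatFunc L)).comp (mapRingHom σ)) fun p hp => by
    rw [Submonoid.mem_comap, mem_nonZeroDivisors_iff_ne_zero]
    exact RatFunc.algebraMap_ne_zero
      ((Polynomial.map_ne_zero_iff σ.injective).2 (nonZeroDivisors.ne_zero hp))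

lemma baseChange_algebraMap (p : K[X]) :
    baseChange σ (algebraMap K[X] (RatFunc K) p) = algebraMap L[X] (RatFunc L) (p.map σ) := by
  rw [baseChange, RatFunc.liftRingHom_algebraMap]
  rfl

lemma baseChange_C (c : K) : baseChange σ (RatFunc.C c) = RatFunc.C (σ c) := by
  rw [← RatFunc.algebraMap_C, baseChange_algebraMap, map_C, RatFunc.algebraMap_C]

lemma baseChange_X : baseChange σ RatFunc.X = RatFunc.X := by
  rw [← RatFunc.algebraMap_X, baseChange_algebraMap, map_X, RatFunc.algebraMap_X]

lemma baseChange_eq_div (φ : RatFunc K) : baseChange σ φ =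
    algebraMap L[X] (RatFunc L) (φ.num.map σ) / algebraMap L[X] (RatFunc L) (φ.denom.map σ) := by
  conv_lhs => rw [← RatFunc.num_div_denom φ]
  rw [map_div₀, baseChange_algebraMap, baseChange_algebraMap]

lemma num_denom_of_isCoprime {a b : L[X]} (hab : IsCoprime a b) (hb : b.Monic) {ψ : RatFunc L}
    (hψ : ψ = algebraMap L[X] (RatFunc L) a / algebraMap L[X] (RatFunc L) b) :
    ψ.num = a ∧ ψ.denom = b := by
  have h := (RatFunc.num_mul_eq_mul_denom_iff hb.ne_zero).2 hψ
  have h1 : ψ.denom ∣ b :=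
    (RatFunc.isCoprime_num_denom ψ).symm.dvd_of_dvd_mul_left ⟨a, by rw [h]; ring⟩
  have h2 : b ∣ ψ.denom := hab.symm.dvd_of_dvd_mul_left ⟨ψ.num, by rw [← h]; ring⟩
  have h3 : ψ.denom = b :=
    eq_of_monic_of_associated ψ.monic_denom hb (associated_of_dvd_dvd h1 h2)
  rw [h3] at h
  exact ⟨mul_right_cancel₀ hb.ne_zero h, h3⟩

/-- Coprimality and a monic denominator characterise the reduced fraction, and both survive field
extension. -/
lemma num_denom_baseChange (φ : RatFunc K) :
    (baseChange σ φ).num = φ.num.map σ ∧ (baseChange σ φ).denom = φ.denom.map σ := by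
  refine num_denom_of_isCoprime ?_ (φ.monic_denom.map σ) (baseChange_eq_div σ φ)
  exact (RatFunc.isCoprime_num_denom φ).map (mapRingHom σ)

lemma degree_baseChange (φ : RatFunc K) : degree (baseChange σ φ) = degree φ := by
  rw [degree, degree, (num_denom_baseChange σ φ).1, (num_denom_baseChange σ φ).2, natDegree_map,
    natDegree_map]

lemma toMap_baseChange (φ : RatFunc K) (P : OnePoint K) :
    toMap (baseChange σ φ) (P.map σ) = (toMap φ P).map σ := by
  classical
  obtain ⟨hn, hd⟩ := num_denom_baseChange σ φ
  induction P using OnePoint.rec with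
  | infty =>
    rw [OnePoint.map_infty, toMap_infty, toMap_infty, hn, hd, natDegree_map, natDegree_map]
    split_ifs
    · rfl
    · rw [coeff_map, leadingCoeff_map, ← map_div₀]
      rfl
  | coe x =>
    rw [OnePoint.map_some, toMap_coe, toMap_coe, hn, hd, eval_map_apply, eval_map_apply,
      map_eq_zero]
    split_ifs
    · rfl
    · rw [← map_div₀]
      rfl

lemma baseChange_comp (φ ψ : RatFunc K) :
    baseChange σ (comp φ ψ) = comp (baseChange σ φ) (baseChange σ ψ) := by
  obtain ⟨hn, hd⟩ := num_denom_baseChange σ φ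
  have hC : (baseChange σ).comp RatFunc.C = RatFunc.C.comp σ := RingHom.ext (baseChange_C σ)
  rw [comp, comp, RatFunc.eval, RatFunc.eval, hn, hd, map_div₀, hom_eval₂, hom_eval₂, hC,
    eval₂_map, eval₂_map]

lemma baseChange_iter (φ : RatFunc K) (n : ℕ) :
    baseChange σ (iter φ n) = iter (baseChange σ φ) n := by
  induction n with
  | zero => exact baseChange_X σ
  | succ n ih => rw [iter, iter, baseChange_comp, ih]

lemma derivAt_baseChange (ψ : RatFunc K) (x : K) :
    derivAt (baseChange σ ψ) (σ x) = σ (derivAt ψ x) := by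
  obtain ⟨hn, hd⟩ := num_denom_baseChange σ ψ
  simp only [derivAt, hn, hd, derivative_map, eval_map_apply, map_div₀, map_sub, map_mul, map_pow]

lemma fixedMultiplier_baseChange (ψ : RatFunc K) (P : OnePoint K) :
    fixedMultiplier (baseChange σ ψ) (P.map σ) = σ (fixedMultiplier ψ P) := by
  induction P using OnePoint.rec with
  | infty =>
    change derivAt (comp (baseChange σ ψ) RatFunc.X⁻¹)⁻¹ 0 =
      σ (derivAt (comp ψ RatFunc.X⁻¹)⁻¹ 0)
    rw [← derivAt_baseChange, map_inv₀, baseChange_comp, map_inv₀, baseChange_X, map_zero]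
  | coe x => exact derivAt_baseChange σ ψ x

lemma map_injective_onePoint : Function.Injective (OnePoint.map σ) :=
  Option.map_injective σ.injective

lemma semiconj_toMap (φ : RatFunc K) :
    Function.Semiconj (OnePoint.map σ) (toMap φ) (toMap (baseChange σ φ)) :=
  fun P => (toMap_baseChange σ φ P).symm

lemma isPeriodicPt_baseChange_iff (φ : RatFunc K) (P : OnePoint K) (n : ℕ) :
    Function.IsPeriodicPt (toMap (baseChange σ φ)) n (P.map σ) ↔
      Function.IsPeriodicPt (toMap φ) n P := by
  rw [Function.IsPeriodicPt, Function.IsFixedPt, ← (semiconj_toMap σ φ).iterate_right n P,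
    (map_injective_onePoint σ).eq_iff]
  rfl

lemma multiplier_baseChange (φ : RatFunc K) (P : OnePoint K) :
    multiplier (baseChange σ φ) (P.map σ) = σ (multiplier φ P) := by
  have h : Function.minimalPeriod (toMap (baseChange σ φ)) (P.map σ) =
      Function.minimalPeriod (toMap φ) P :=
    Function.minimalPeriod_eq_minimalPeriod_iff.2 (isPeriodicPt_baseChange_iff σ φ P)
  rw [multiplier, multiplier, h, ← baseChange_iter, fixedMultiplier_baseChange]

end BaseChange

lemma IsAttractingFamily.baseChange {K L : Type*} [NormedField K] [NormedField L] {σ : K →+* L}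
    (hσ : ∀ x, ‖σ x‖ = ‖x‖) {ι : Type*} {φ : RatFunc K} {γ : ι → OnePoint K}
    (h : IsAttractingFamily φ γ) :
    IsAttractingFamily (baseChange σ φ) fun a => (γ a).map σ where
  mem_periodicPts a := by
    obtain ⟨n, hn, hper⟩ := h.mem_periodicPts a
    exact ⟨n, hn, (isPeriodicPt_baseChange_iff σ φ _ n).2 hper⟩
  norm_multiplier_lt a := by
    rw [multiplier_baseChange, hσ]
    exact h.norm_multiplier_lt a
  eq_of_iterate_eq a b k hk := by
    rw [← (semiconj_toMap σ φ).iterate_right k] at hk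
    exact h.eq_of_iterate_eq a b k (map_injective_onePoint σ hk)

/-! ### Isometric algebraically closed extensions -/

section Extension

universe u

/-- A normed field is ultrametric as soon as natural numbers have norm at most 1, and these already
lie in K. -/
lemma isUltrametricDist_of_isometric {K L : Type*} [NormedField K] [IsUltrametricDist K]
    [NormedField L] {σ : K →+* L} (hσ : ∀ x, ‖σ x‖ = ‖x‖) : IsUltrametricDist L := by
  rw [isUltrametricDist_iff_forall_norm_natCast_le_one]
  intro n
  rw [← map_natCast σ, hσ]
  exact IsUltrametricDist.norm_natCast_le_one K n

lemma exists_isAlgClosed_extension_of_complete (K : Type u) [NontriviallyNormedField K]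
    [IsUltrametricDist K] [CompleteSpace K] :
    ∃ (L : Type u) (_ : NormedField L) (_ : IsAlgClosed L) (σ : K →+* L), ∀ x, ‖σ x‖ = ‖x‖ :=
  ⟨AlgebraicClosure K, spectralNorm.normedField K (AlgebraicClosure K), inferInstance,
    algebraMap K (AlgebraicClosure K), spectralNorm_extends⟩

/-- Every ultrametric normed field embeds isometrically into an algebraically closed one. -/
lemma exists_isAlgClosed_extension (K : Type u) [NormedField K] [IsUltrametricDist K] :
    ∃ (L : Type u) (_ : NormedField L) (_ : IsAlgClosed L) (σ : K →+* L), ∀ x, ‖σ x‖ = ‖x‖ := by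
  -- A nontrivial absolute value extends to the completion and then, by the spectral norm, to its
  -- algebraic closure. A trivial one extends trivially.
  by_cases hK : ∃ x : K, 1 < ‖x‖
  · let coe : K →+* UniformSpace.Completion K := UniformSpace.Completion.coeRingHom
    have hcoe : ∀ x, ‖coe x‖ = ‖x‖ := UniformSpace.Completion.norm_coe
    have hu : IsUltrametricDist (UniformSpace.Completion K) := isUltrametricDist_of_isometric hcoe
    let _ : NontriviallyNormedField (UniformSpace.Completion K) :=
      { (inferInstance : NormedField (UniformSpace.Completion K)) with
        non_trivial := hK.imp' coe fun x hx => (hcoe x).symm ▸ hx }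
    obtain ⟨L, hL, hL', σ, hσ⟩ :=
      exists_isAlgClosed_extension_of_complete (UniformSpace.Completion K)
    exact ⟨L, hL, hL', σ.comp coe, fun x => (hσ _).trans (hcoe x)⟩
  · push Not at hK
    classical
    have h1 : ∀ x : K, x ≠ 0 → ‖x‖ = 1 := by
      intro x hx
      refine le_antisymm (hK x) ?_
      have := hK x⁻¹
      rw [norm_inv] at this
      exact (inv_le_one₀ (norm_pos_iff.2 hx)).1 this
    let v : AbsoluteValue (AlgebraicClosure K) ℝ := AbsoluteValue.trivial
    refine ⟨AlgebraicClosure K, v.toNormedField, inferInstance,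
      algebraMap K (AlgebraicClosure K), fun x => ?_⟩
    change v (algebraMap K (AlgebraicClosure K) x) = ‖x‖
    by_cases hx : x = 0
    · rw [hx, map_zero, map_zero, norm_zero]
    · rw [h1 x hx]
      exact AbsoluteValue.trivial_apply ((_root_.map_ne_zero _).2 hx)

end Extension

/-- Integers that are not divisible by the residue characteristic have absolute value one. -/
lemma norm_natCast_eq_one_of_not_dvd {K : Type*} [NormedField K] [IsUltrametricDist K] (p : ℕ)
    [CharP (ResidueField K) p] {m : ℕ} (hm : ¬ p ∣ m) : ‖(m : K)‖ = 1 := by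
  refine le_antisymm (IsUltrametricDist.norm_natCast_le_one K m) ?_
  by_contra! hlt
  apply hm
  let A := (NormedField.valuation (K := K)).valuationSubring
  have h1 : (m : A) ∈ IsLocalRing.maximalIdeal A := by
    rw [IsLocalRing.mem_maximalIdeal, mem_nonunits_iff]
    intro hu
    obtain ⟨v, hv⟩ := hu.exists_right_inv
    have hv1 : ‖(v : K)‖ ≤ 1 := by
      have := (Valuation.mem_valuationSubring_iff _ _).1 v.2
      rw [NormedField.valuation_apply] at this
      exact_mod_cast this
    have hmul : (m : K) * (v : K) = 1 := by
      have := congrArg (Subtype.val : A → K) hv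
      simpa using this
    have hn := congrArg norm hmul
    rw [norm_mul, norm_one] at hn
    exact absurd hn (mul_lt_one_of_nonneg_of_lt_one_left (norm_nonneg _) hlt hv1).ne
  have h2 : ((m : ℕ) : ResidueField K) = 0 := by
    rw [← map_natCast (IsLocalRing.residue A)]
    exact (IsLocalRing.residue_eq_zero_iff _).2 h1
  exact (CharP.cast_eq_zero_iff (ResidueField K) p m).1 h2

end RatDyn

/-! ### The theorem over K -/

theorem corollary1p5 {K : Type*} [NormedField K] [IsUltrametricDist K]
    (p : ℕ) [CharP (RatDyn.ResidueField K) p]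
    (d : ℕ) (hd : 2 ≤ d) (hp : d < p ∨ p = 0)
    (φ : RatFunc K) (hφ : RatDyn.degree φ = d) :
    (RatDyn.attractingCycles φ).encard ≤ ((2 * d - 2 : ℕ) : ℕ∞) := by
  obtain ⟨L, _, _, σ, hσ⟩ := RatDyn.exists_isAlgClosed_extension K
  have : IsUltrametricDist L := RatDyn.isUltrametricDist_of_isometric hσ
  -- One periodic point is chosen on each cycle; if the orbit of one meets another, their cycles
  -- coincide.
  choose γ hγ hm horb using fun c : RatDyn.attractingCycles φ => c.2
  have hfam : RatDyn.IsAttractingFamily φ γ := by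
    refine ⟨hγ, hm, fun a b k hk => Subtype.ext ?_⟩
    rw [horb a, horb b, ← hk, Function.periodicOrbit_apply_iterate_eq (hγ a)]
  have := (hfam.baseChange hσ).card_le (by rwa [RatDyn.degree_baseChange, hφ]) ?_
  · rwa [RatDyn.degree_baseChange, hφ] at this
  · intro m hm1 hmd
    rw [RatDyn.degree_baseChange, hφ] at hmd
    rw [← map_natCast σ, hσ]
    refine RatDyn.norm_natCast_eq_one_of_not_dvd p fun hdvd => ?_
    rcases hp with hp | rfl
    · exact absurd (Nat.le_of_dvd (by omega) hdvd) (by omega)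
    · rw [zero_dvd_iff] at hdvd
      omega
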